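/- Let $\Gamma^2=(V,L)$ be the Cayley tree of order $2$ (the infinite tree in which every vertex has exactly $3$ neighbours), fix a root $x^0\in V$, and let $V_n$ and $W_n$ be the ball and the sphere of radius $n$ around $x^0$. Let $\beta>0$, and equip the spin space $[0,1]$ with Lebesgue measure and $[0,1]^V$ with the product $\sigma$-algebra. Consider the model with formal Hamiltonian $$H(\sigma)=-\frac1\beta\sum_{\langle x,y\rangle\in L}\ln\Bigl(1+\tfrac{14}{15}\sqrt[5]{4\bigl(\sigma(x)-\tfrac12\bigr)\bigl(\sigma(y)-\tfrac12\bigr)}\Bigr),\qquad \sigma\in[0,1]^V,$$ where $\sqrt[5]{\cdot}$ is the real (odd) fifth root and every edge is counted once. Put $$K(t,u)=1+\tfrac{14}{15}\sqrt[5]{4\bigl(t-\tfrac12\bigr)\bigl(u-\tfrac12\bigr)},\qquad (H_2f)(t)=\int_0^1K(t,u)f(u)^2\,du,$$ $$f_1(t)=1,\qquad f_2(t)=\frac34+\sqrt{\frac{21}{5}}\,\frac{\sqrt[5]{2}}{4}\,\sqrt[5]{t-\tfrac12},\qquad t\in[0,1].$$ Then $f_1\neq f_2$ are strictly positive continuous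 fixed points of the Hammerstein operator $H_2$, and the model has at least two translation-invariant Gibbs measures: there are probability measures $\mu_1\ne\mu_2$ on $[0,1]^V$ such that each $\mu_i$ satisfies the DLR equations for $H$ at inverse temperature $\beta$ (for all finite subsets of $V$), is invariant under all automorphisms of the tree (in particular under translations), and is the splitting Gibbs measure corresponding to $f_i$. The last property means that, with $h_{t,x}=2\ln\bigl(f_i(t)/f_i(0)\bigr)$ for $x\in V\setminus\{x^0\}$ and $t\in[0,1]$, for every $n\ge1$ the restriction of $\mu_i$ to $[0,1]^{V_n}$ has density $$\sigma_n\mapsto Z_n^{-1}\exp\Bigl(-\beta H(\sigma_n)+\sum_{x\in W_n}h_{\sigma_n(x),x}\Bigr)$$ with respect to the product Lebesgue measure, where $H(\sigma_n)$ is the sum over the edges inside $V_n$ and $Z_n$ is the normalising constant. -/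

import Mathlib

open MeasureTheory
open scoped ENNReal

noncomputable section

namespace CayleyGibbs

/-! ### The Cayley tree -/

/-- A Cayley tree of order `k`: a (nonempty, connected, acyclic) tree in which every vertex is
incident to exactly `k + 1` edges. -/
def IsCayleyTree {V : Type*} (G : SimpleGraph V) [G.LocallyFinite] (k : ℕ) : Prop :=
  G.IsTree ∧ ∀ x : V, G.degree x = k + 1

/-- Balls of a locally finite graph are finite. -/
theorem finite_ball {V : Type*} (G : SimpleGraph V) [G.LocallyFinite] (x₀ : V) (n : ℕ) :
    {x : V | G.edist x₀ x ≤ n}.Finite := by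
  induction n with
  | zero =>
    refine (Set.finite_singleton x₀).subset ?_
    intro x hx
    have h0 : G.edist x₀ x = 0 := nonpos_iff_eq_zero.1 (by exact_mod_cast (show G.edist x₀ x ≤ ((0 : ℕ) : ℕ∞) from hx))
    exact (SimpleGraph.edist_eq_zero_iff.1 h0).symm
  | succ n ih =>
    refine (ih.union (ih.biUnion fun y _ => (G.neighborFinset y).finite_toSet)).subset ?_
    intro x hx
    have hx' : G.edist x₀ x ≤ ((n + 1 : ℕ) : ℕ∞) := hx
    obtain ⟨m, hm⟩ := ENat.ne_top_iff_exists.1 (ne_top_of_le_ne_top (ENat.natCast_ne_top _) hx')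
    obtain ⟨p, hp⟩ := SimpleGraph.exists_walk_of_edist_eq_coe (G := G) hm.symm
    have hmn : m ≤ n + 1 := by rw [← hm] at hx'; exact_mod_cast hx'
    by_cases hle : m ≤ n
    · left
      show G.edist x₀ x ≤ n
      rw [← hm]
      exact_mod_cast hle
    · right
      have hq : p.reverse.length = m := by simpa using hp
      cases hr : p.reverse with
      | nil => rw [hr] at hq; simp at hq; omega
      | @cons _ y _ hadj q =>
        rw [hr] at hq
        simp only [SimpleGraph.Walk.length_cons] at hq
        simp only [Set.mem_iUnion]
        refine ⟨y, ?_, ?_⟩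
        · show G.edist x₀ y ≤ n
          refine (SimpleGraph.edist_le q.reverse).trans ?_
          simp only [SimpleGraph.Walk.length_reverse]
          exact_mod_cast (by omega : q.length ≤ n)
        · simpa using hadj.symm

/-- The ball `V_n = {x : d(x₀, x) ≤ n}` of the graph. -/
def ball {V : Type*} (G : SimpleGraph V) [G.LocallyFinite] (x₀ : V) (n : ℕ) : Finset V :=
  (finite_ball G x₀ n).toFinset

theorem mem_ball {V : Type*} (G : SimpleGraph V) [G.LocallyFinite] (hG : G.Connected)
    (x₀ x : V) (n : ℕ) : x ∈ ball G x₀ n ↔ G.dist x₀ x ≤ n := by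
  have h : ((G.dist x₀ x : ℕ) : ℕ∞) = G.edist x₀ x := (hG x₀ x).coe_dist_eq_edist
  simp only [ball, Set.Finite.mem_toFinset, Set.mem_ofPred_eq, ← h, Nat.cast_le]

/-! ### Nearest-neighbour Hamiltonians and Gibbs measures

Spins take values in `unitInterval` (`[0,1]`), whose a priori measure `volume` is Lebesgue measure.
A nearest-neighbour interaction is a symmetric function `Φ` of two spins, i.e. a function on
unordered pairs; the formal Hamiltonian is `H(σ) = ∑_{⟨x,y⟩} Φ(σ(x), σ(y))`, every (unoriented)
edge being counted once. The configuration space `V → unitInterval` carries the product σ-algebra. -/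

open Classical in
/-- `H(s)`: the energy of a configuration `s` on the finite set `Λ`, summed over all edges with
both endpoints in `Λ`. -/
def energy {V : Type*} (G : SimpleGraph V) (Φ : Sym2 unitInterval → ℝ) (Λ : Finset V) (s : Λ → unitInterval) : ℝ :=
  ∑ e ∈ (G.comap (Subtype.val : Λ → V)).edgeFinset, Φ (e.map s)

open Classical in
/-- `U(s, ω)`: the interaction energy between the configuration `s` on `Λ` and the outside
configuration `ω`, summed over all edges with one endpoint in `Λ` and the other outside `Λ`. -/
def boundaryEnergy {V : Type*} (G : SimpleGraph V) [G.LocallyFinite] (Φ : Sym2 unitInterval → ℝ)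
    (Λ : Finset V) (s : Λ → unitInterval) (ω : V → unitInterval) : ℝ :=
  ∑ x : Λ, ∑ y ∈ (G.neighborFinset (x : V)).filter (fun y => y ∉ Λ), Φ s(s x, ω y)

open Classical in
/-- The configuration equal to `s` on `Λ` and to `ω` outside `Λ`. -/
def glue {V : Type*} (Λ : Finset V) (s : Λ → unitInterval) (ω : V → unitInterval) : V → unitInterval :=
  fun x => if hx : x ∈ Λ then s ⟨x, hx⟩ else ω x

/-- The a priori measure `λ_Λ` on configurations on the finite set `Λ`. -/
def aPriori {V : Type*} (Λ : Finset V) : Measure (Λ → unitInterval) :=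
  Measure.pi fun _ => (volume : Measure unitInterval)

/-- The Boltzmann weight `exp(-β (H(s) + U(s, ω)))`. -/
def gibbsWeight {V : Type*} (G : SimpleGraph V) [G.LocallyFinite] (Φ : Sym2 unitInterval → ℝ) (β : ℝ)
    (Λ : Finset V) (ω : V → unitInterval) (s : Λ → unitInterval) : ℝ≥0∞ :=
  ENNReal.ofReal (Real.exp (-β * (energy G Φ Λ s + boundaryEnergy G Φ Λ s ω)))

/-- The conditional Gibbs distribution in `Λ` with boundary condition `ω`, as a measure on
configurations on `Λ`: it has density `exp(-β H(s ‖ ω)) / Z_Λ(ω)` with respect to `λ_Λ`. -/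
def gibbsSpec {V : Type*} (G : SimpleGraph V) [G.LocallyFinite] (Φ : Sym2 unitInterval → ℝ) (β : ℝ)
    (Λ : Finset V) (ω : V → unitInterval) : Measure (Λ → unitInterval) :=
  (aPriori Λ).withDensity fun s =>
    gibbsWeight G Φ β Λ ω s / ∫⁻ s', gibbsWeight G Φ β Λ ω s' ∂(aPriori Λ)

/-- `μ` is a Gibbs measure: a probability measure satisfying the DLR equations
`μ(B) = ∫ γ_Λ(B | ω) μ(dω)` for all finite `Λ` and all measurable `B`. -/
def IsGibbsMeasure {V : Type*} (G : SimpleGraph V) [G.LocallyFinite] (Φ : Sym2 unitInterval → ℝ) (β : ℝ)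
    (μ : Measure (V → unitInterval)) : Prop :=
  IsProbabilityMeasure μ ∧
    ∀ (Λ : Finset V) (B : Set (V → unitInterval)), MeasurableSet B →
      μ B = ∫⁻ ω, gibbsSpec G Φ β Λ ω {s | glue Λ s ω ∈ B} ∂μ

open Classical in
/-- The weight `exp(-β H(s) + ∑_{x ∈ W_n} h_{s(x), x})` on configurations on the ball `V_n`,
where `W_n` is the sphere of radius `n` around `x₀`. Here `h x t` stands for `h_{t, x}`. -/
def splittingWeight {V : Type*} (G : SimpleGraph V) [G.LocallyFinite] (Φ : Sym2 unitInterval → ℝ) (β : ℝ)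
    (x₀ : V) (h : V → unitInterval → ℝ) (n : ℕ) (s : ball G x₀ n → unitInterval) : ℝ≥0∞ :=
  ENNReal.ofReal (Real.exp (-β * energy G Φ (ball G x₀ n) s +
    ∑ x : ball G x₀ n, if G.dist x₀ (x : V) = n then h x (s x) else 0))

/-- The distribution `μ^{(n)}` on configurations on `V_n`, with density
`Z_n⁻¹ exp(-β H(s) + ∑_{x ∈ W_n} h_{s(x), x})` with respect to `λ_{V_n}`. -/
def splittingMarginal {V : Type*} (G : SimpleGraph V) [G.LocallyFinite] (Φ : Sym2 unitInterval → ℝ) (β : ℝ)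
    (x₀ : V) (h : V → unitInterval → ℝ) (n : ℕ) : Measure (ball G x₀ n → unitInterval) :=
  (aPriori (ball G x₀ n)).withDensity fun s =>
    splittingWeight G Φ β x₀ h n s /
      ∫⁻ s', splittingWeight G Φ β x₀ h n s' ∂(aPriori (ball G x₀ n))

/-- `μ` is the splitting Gibbs measure corresponding to the interaction `Φ` and the function
`x ↦ h_x`, `x ≠ x₀`: a probability measure whose restriction to `V_n` is `μ^{(n)}` for every
`n ≥ 1`. (The value of `h` at `x₀` plays no role.) -/
def IsSplittingGibbsMeasure {V : Type*} (G : SimpleGraph V) [G.LocallyFinite] (Φ : Sym2 unitInterval → ℝ)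
    (β : ℝ) (x₀ : V) (h : V → unitInterval → ℝ) (μ : Measure (V → unitInterval)) : Prop :=
  IsProbabilityMeasure μ ∧
    ∀ n : ℕ, 1 ≤ n →
      μ.map (fun (σ : V → unitInterval) (x : ball G x₀ n) => σ x) = splittingMarginal G Φ β x₀ h n

/-- Invariance of `μ` under all automorphisms of the graph. On a Cayley tree this contains
invariance under the translations, whichever simply transitive group of automorphisms the tree
is identified with. -/
def IsTranslationInvariant {V : Type*} (G : SimpleGraph V) (μ : Measure (V → unitInterval)) : Prop :=
  ∀ φ : G ≃g G, μ.map (fun (σ : V → unitInterval) (x : V) => σ (φ x)) = μ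

/-! ### Hammerstein operators -/

/-- The kernel `K(t, u) = exp(-β Φ(t, u))` of the interaction `Φ`. -/
def kernel (Φ : Sym2 unitInterval → ℝ) (β : ℝ) (t u : unitInterval) : ℝ := Real.exp (-β * Φ s(t, u))

/-- Hammerstein's integral operator of order `k`: `(H_k f)(t) = ∫₀¹ K(t, u) f(u)^k du`. -/
def hammerstein (K : unitInterval → unitInterval → ℝ) (k : ℕ) (f : unitInterval → ℝ) (t : unitInterval) : ℝ := ∫ u : unitInterval, K t u * f u ^ k

/-! ### The model -/

/-- The real fifth root, an odd function on the whole real line. -/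
def fifthRoot (x : ℝ) : ℝ := SignType.sign x * |x| ^ (1 / 5 : ℝ)

theorem fifthRoot_pow (x : ℝ) : fifthRoot x ^ 5 = x := by
  have h : (|x| ^ (1 / 5 : ℝ)) ^ 5 = |x| := by
    rw [← Real.rpow_natCast, ← Real.rpow_mul (abs_nonneg x)]; norm_num
  rw [fifthRoot, mul_pow, h]
  rcases lt_trichotomy x 0 with hx | hx | hx
  · rw [sign_neg hx, abs_of_neg hx]; norm_num
  · simp [hx]
  · rw [sign_pos hx, abs_of_pos hx]; norm_num

/-- The interaction
`Φ(t, u) = -(1/β) ln (1 + (14/15) (4 (t - 1/2) (u - 1/2))^{1/5})`. -/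
def modelInteraction (β : ℝ) : Sym2 unitInterval → ℝ :=
  Sym2.lift ⟨fun t u =>
    -(1 / β) * Real.log (1 + 14 / 15 * fifthRoot (4 * ((t : ℝ) - 1 / 2) * ((u : ℝ) - 1 / 2))),
    fun t u => by
      show _ * Real.log _ = _ * Real.log _
      rw [mul_right_comm]⟩

/-- The constant function `f₁ ≡ 1`. -/
def f₁ : unitInterval → ℝ := fun _ => 1

/-- `f₂(t) = 3/4 + √(21/5) (2^{1/5} / 4) (t - 1/2)^{1/5}`. -/
def f₂ : unitInterval → ℝ := fun t =>
  3 / 4 + √(21 / 5) * (fifthRoot 2 / 4) * fifthRoot ((t : ℝ) - 1 / 2)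

/-- The function `h_{t, x} = 2 ln (f(t) / f(0))`, the same at all vertices, so that
`exp(h_{t, x} - h_{0, x}) = (f(t) / f(0))²`. -/
def boundaryField {V : Type*} (f : unitInterval → ℝ) : V → unitInterval → ℝ := fun _ t => 2 * Real.log (f t / f 0)

end CayleyGibbs

end

/-!
Let `f` be a positive continuous fixed point of `H_k` on the Cayley tree of order `k`, and let `A` be
the vertex set of a finite subtree. Consider on configurations on `A` the density
`∏ exp(-β Φ(σ x, σ y)) ∏ f(σ x)`, where the first product is over the edges inside `A` and the second
over the edges leaving `A`, with endpoint `x ∈ A` (`weight`). If a leaf `y`, attached to `x ∈ A`, is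
added to `A`, then `y` has `k` further edges, and integrating out `σ y` gives
`∫ K(σ x, u) f(u)^k du = f(σ x)`, the factor of the edge from `x` to `y` in the density on `A`. So the
fixed point equation says exactly that the densities on finite subtrees are consistent
(`IsPositiveFixedPoint.lmarginal_sdiff_weight`), and all of them have total mass `∫ f^(k+1)`. The
chain of leaves between two subtrees comes from `subtree_induction`; acyclicity enters through the
fact that a vertex outside a subtree has at most one neighbour in it.

A measure `μ` with these marginals exists because the probability measures on the compact space
`[0,1]^V` form a compact space: a limit point of the finite volume distributions on balls has the
right marginals (`exists_hasSubtreeDensities`). It has all the required properties: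

* The family of densities on *all* finite subtrees makes no reference to a root, so `μ` is invariant
  under automorphisms (`HasSubtreeDensities.isTranslationInvariant`).
* If `A` contains `Λ` and its neighbours, the density on `A` is the Boltzmann weight of `Λ` times a
  function of the spins outside `Λ`. This gives the DLR equations
  (`HasSubtreeDensities.isGibbsMeasure`).
* A vertex of the sphere of radius `n ≥ 1` has one neighbour in the ball and hence `k` edges leaving
  it, so that for `k = 2` the density on the ball is that of the splitting Gibbs measure of `f`
  (`HasSubtreeDensities.isSplittingGibbsMeasure`).
* A single spin has density proportional to `f^(k+1)`, so non-proportional functions `f` give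
  different measures (`HasSubtreeDensities.mul_eq_mul`).

For the model at hand, put `a(t) = (2 (t - 1/2))^{1/5}`. The kernel is `1 + (14/15) a(t) a(u)`, the
odd moments of `a` vanish and `∫ a² = 5/7`, so `H_2` maps `p + q a` to
`p² + (5/7) q² + (4/3) p q a` (`hammerstein_affine`). Both `(p, q) = (1, 0)` and
`(p, q) = (3/4, √(21/5) / 4)` are fixed.
-/

open MeasureTheory
open scoped ENNReal

noncomputable section

namespace CayleyGibbs

/-! ### Finite subtrees -/

/-- In an acyclic graph a vertex outside a connected set has at most one neighbour in it: two
neighbours would give two different paths between them, one inside the set and one through the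
vertex. -/
theorem eq_of_adj_of_induce_preconnected {V : Type*} {G : SimpleGraph V} (hG : G.IsAcyclic)
    {A : Set V} (hA : (G.induce A).Preconnected) {x x' y : V} (hx : x ∈ A) (hx' : x' ∈ A)
    (hy : y ∉ A) (h : G.Adj y x) (h' : G.Adj y x') : x = x' := by
  classical
  by_contra hne
  obtain ⟨p⟩ := hA ⟨x, hx⟩ ⟨x', hx'⟩
  let q : G.Walk x x' := p.map (SimpleGraph.Embedding.induce A).toHom
  have hq : ∀ v ∈ q.support, v ∈ A := by
    intro v hv
    have hv' : v ∈ (p.map (SimpleGraph.Embedding.induce A).toHom).support := hv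
    rw [SimpleGraph.Walk.support_map, List.mem_map] at hv'
    obtain ⟨a, -, rfl⟩ := hv'
    exact a.2
  let r : G.Walk x x' := .cons h.symm (.cons h' .nil)
  have hr : r.IsPath := by
    simp [r, SimpleGraph.Walk.cons_isPath_iff, hne, h.ne', h'.ne]
  have heq : (⟨r, hr⟩ : G.Path x x') = q.toPath :=
    (hG.subsingleton_path x x').elim _ _
  have hyr : y ∈ (q.toPath : G.Walk x x').support := by
    rw [← heq]
    simp [r]
  exact hy (hq y (q.support_bypass_subset_support hyr))

theorem induce_insert_connected {V : Type*} {G : SimpleGraph V} {A : Set V}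
    (hA : (G.induce A).Connected) {x y : V} (hx : x ∈ A) (h : G.Adj x y) :
    (G.induce (insert y A)).Connected := by
  have hy : (G.induce ({y} : Set V)).Preconnected := by
    rintro ⟨a, rfl⟩ ⟨b, rfl⟩
    rfl
  have := SimpleGraph.connected_induce_union hA.preconnected hy hx rfl h
  rwa [Set.union_singleton] at this

theorem induce_singleton_connected {V : Type*} (G : SimpleGraph V) (x : V) :
    (G.induce ({x} : Set V)).Connected :=
  { preconnected := by
      rintro ⟨a, rfl⟩ ⟨b, rfl⟩
      rfl
    nonempty := ⟨⟨x, rfl⟩⟩ }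

theorem exists_adj_of_induce_preconnected {V : Type*} {G : SimpleGraph V} {A B : Set V}
    (hB : (G.induce B).Preconnected) (hAB : A ⊆ B) (hA : A.Nonempty) {z : V} (hzB : z ∈ B)
    (hzA : z ∉ A) : ∃ x ∈ A, ∃ y ∈ B, y ∉ A ∧ G.Adj x y := by
  obtain ⟨a, ha⟩ := hA
  obtain ⟨p⟩ := hB ⟨a, hAB ha⟩ ⟨z, hzB⟩
  obtain ⟨d, -, h1, h2⟩ := p.exists_boundary_dart {v | (v : V) ∈ A} ha hzA
  exact ⟨d.fst, h1, d.snd, d.snd.2, h2, d.adj⟩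

theorem induce_ball_connected {V : Type*} (G : SimpleGraph V) [G.LocallyFinite] (hG : G.Connected)
    (x₀ : V) (n : ℕ) : (G.induce (ball G x₀ n : Set V)).Connected := by
  classical
  refine SimpleGraph.induce_connected_of_patches x₀ (by simp [mem_ball G hG]) fun {v} hv => ?_
  obtain ⟨p, hp⟩ := hG.exists_walk_length_eq_dist x₀ v
  refine ⟨{w | w ∈ p.support}, ?_, p.start_mem_support, p.end_mem_support,
    p.connected_induce_support _ _⟩
  intro w hw
  rw [Finset.mem_coe, mem_ball G hG] at hv ⊢
  refine le_trans ?_ hv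
  rw [← hp]
  exact (SimpleGraph.dist_le (p.takeUntil w hw)).trans (p.length_takeUntil_le_length hw)

theorem ball_mono {V : Type*} (G : SimpleGraph V) [G.LocallyFinite] (hG : G.Connected)
    (x₀ : V) {m n : ℕ} (h : m ≤ n) : ball G x₀ m ⊆ ball G x₀ n := fun x hx => by
  rw [mem_ball G hG] at hx ⊢
  exact hx.trans h

theorem exists_subset_ball {V : Type*} (G : SimpleGraph V) [G.LocallyFinite] (hG : G.Connected)
    (x₀ : V) (A : Finset V) : ∃ n, 1 ≤ n ∧ A ⊆ ball G x₀ n := by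
  refine ⟨A.sup (G.dist x₀) + 1, by omega, fun x hx => ?_⟩
  rw [mem_ball G hG]
  exact (Finset.le_sup (f := G.dist x₀) hx).trans (Nat.le_succ _)

theorem countable_of_connected {V : Type*} (G : SimpleGraph V) [G.LocallyFinite]
    (hG : G.Connected) : Countable V := by
  obtain ⟨x₀⟩ := hG.nonempty
  refine Set.countable_univ_iff.1 ((Set.countable_iUnion fun n =>
    (ball G x₀ n).countable_toSet).mono fun x _ => ?_)
  simp only [Set.mem_iUnion, Finset.mem_coe, mem_ball G hG]
  exact ⟨_, le_rfl⟩

theorem exists_adj_mem_ball {V : Type*} (G : SimpleGraph V) [G.LocallyFinite]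
    (hG : G.Connected) {x₀ x : V} {n : ℕ} (hx : G.dist x₀ x = n + 1) :
    ∃ z ∈ ball G x₀ n, G.Adj z x := by
  obtain ⟨p, hp⟩ := hG.exists_walk_length_eq_dist x x₀
  rw [SimpleGraph.dist_comm, hx] at hp
  cases p with
  | nil => simp at hp
  | @cons _ z _ h q =>
    refine ⟨z, ?_, h.symm⟩
    rw [mem_ball G hG, SimpleGraph.dist_comm]
    refine (SimpleGraph.dist_le q).trans ?_
    simp at hp
    omega

/-- A vertex at distance `n ≥ 1` from the root has exactly one neighbour in the ball `V_n`. Its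
neighbour one step closer to the root is one; there is no neighbour `z` at distance `n`, since the
connected set `V_{n-1} ∪ {z}` would contain two neighbours of the vertex. -/
theorem card_neighborFinset_inter_ball {V : Type*} [DecidableEq V] (G : SimpleGraph V)
    [G.LocallyFinite] (hG : G.IsTree) (x₀ x : V) {n : ℕ} (hn : 1 ≤ n) (hx : G.dist x₀ x = n) :
    ((G.neighborFinset x).filter (fun y => y ∈ ball G x₀ n)).card = 1 := by
  obtain ⟨n, rfl⟩ : ∃ m, n = m + 1 := ⟨n - 1, by omega⟩
  have hc := hG.connected
  obtain ⟨z, hz, hxz⟩ := exists_adj_mem_ball G hc hx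
  have hxn : x ∉ ball G x₀ n := by
    rw [mem_ball G hc]
    omega
  rw [Finset.card_eq_one]
  refine ⟨z, ?_⟩
  ext w
  simp only [Finset.mem_filter, SimpleGraph.mem_neighborFinset, Finset.mem_singleton]
  constructor
  · rintro ⟨hxw, hw⟩
    by_cases hwn : w ∈ ball G x₀ n
    · exact eq_of_adj_of_induce_preconnected hG.isAcyclic
        (induce_ball_connected G hc x₀ n).preconnected hwn hz hxn hxw hxz.symm
    · -- adjoin `w` to the smaller ball, through a neighbour of `w` in it
      obtain ⟨v, hv, hvw⟩ := exists_adj_mem_ball (n := n) G hc (x₀ := x₀) (x := w) (by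
        rw [mem_ball G hc] at hw hwn
        omega)
      refine eq_of_adj_of_induce_preconnected hG.isAcyclic
        (induce_insert_connected (induce_ball_connected G hc x₀ n) hv hvw).preconnected
        (Set.mem_insert _ _) (Set.mem_insert_of_mem _ hz) ?_ hxw hxz.symm
      rintro (h | h)
      · exact hxw.ne h
      · exact hxn h
  · rintro rfl
    exact ⟨hxz.symm, ball_mono G hc x₀ (Nat.le_succ n) hz⟩

/-- Two finite subtrees `A ⊆ B` are joined by a chain of subtrees, each obtained from the previous
one by adding a leaf. -/
theorem subtree_induction {V : Type*} [DecidableEq V] {G : SimpleGraph V}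
    {B : Finset V} (hB : (G.induce (B : Set V)).Connected) {P : Finset V → Prop} (hP : P B)
    (step : ∀ A : Finset V, A ⊆ B → (G.induce (A : Set V)).Connected → ∀ x ∈ A, ∀ y ∈ B, y ∉ A →
      G.Adj x y → P (insert y A) → P A)
    (A : Finset V) (hAB : A ⊆ B) (hA : (G.induce (A : Set V)).Connected) : P A := by
  induction h : (B \ A).card generalizing A with
  | zero =>
    rw [Finset.card_eq_zero, Finset.sdiff_eq_empty_iff_subset] at h
    rwa [hAB.antisymm h]
  | succ m ih =>
    obtain ⟨z, hz⟩ : (B \ A).Nonempty := by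
      rw [← Finset.card_pos]
      omega
    rw [Finset.mem_sdiff] at hz
    obtain ⟨a⟩ := hA.nonempty
    obtain ⟨x, hx, y, hy, hyA, hxy⟩ := exists_adj_of_induce_preconnected hB.preconnected
      (Finset.coe_subset.2 hAB) ⟨a, a.2⟩ hz.1 hz.2
    refine step A hAB hA x hx y hy hyA hxy (ih _ ?_ ?_ ?_)
    · exact Finset.insert_subset hy hAB
    · rw [Finset.coe_insert]
      exact induce_insert_connected hA hx hxy
    · rw [Finset.sdiff_insert, Finset.card_erase_of_mem (Finset.mem_sdiff.2 ⟨hy, hyA⟩), h]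
      rfl

/-! ### Densities on finite subtrees -/

/-- `f` is a positive continuous fixed point of the Hammerstein operator of order `k` with kernel
`exp(-β Φ)`, where the interaction `Φ` is continuous. -/
structure IsPositiveFixedPoint (Φ : Sym2 unitInterval → ℝ) (β : ℝ) (k : ℕ)
    (f : unitInterval → ℝ) : Prop where
  continuous_interaction : Continuous fun p : unitInterval × unitInterval => Φ s(p.1, p.2)
  continuous : Continuous f
  pos : ∀ t, 0 < f t
  fixed : ∀ t, hammerstein (kernel Φ β) k f t = f t

/-- The logarithm of the (unnormalised) density on configurations on the finite set `A`: every edge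
inside `A` contributes `-β Φ`, and every edge leaving `A` contributes `ln f` of the spin at its
endpoint in `A`. An edge inside `A` is seen from both of its endpoints, whence the factor `1/2`. The
argument is a configuration on all of `V`, of which only the restriction to `A` matters. -/
def logWeight {V : Type*} [DecidableEq V] (G : SimpleGraph V) [G.LocallyFinite]
    (Φ : Sym2 unitInterval → ℝ) (β : ℝ) (f : unitInterval → ℝ) (A : Finset V)
    (σ : V → unitInterval) : ℝ :=
  ∑ x ∈ A, ∑ y ∈ G.neighborFinset x,
    if y ∈ A then -β / 2 * Φ s(σ x, σ y) else Real.log (f (σ x))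

/-- The (unnormalised) density on configurations on the finite set `A`. -/
def weight {V : Type*} [DecidableEq V] (G : SimpleGraph V) [G.LocallyFinite]
    (Φ : Sym2 unitInterval → ℝ) (β : ℝ) (f : unitInterval → ℝ) (A : Finset V)
    (σ : V → unitInterval) : ℝ≥0∞ :=
  ENNReal.ofReal (Real.exp (logWeight G Φ β f A σ))

/-- The total mass `∫ f^(k+1)` of the density on a finite subtree, which is the same for all of
them. -/
def totalMass (k : ℕ) (f : unitInterval → ℝ) : ℝ≥0∞ :=
  ∫⁻ t, ENNReal.ofReal (Real.exp ((k + 1 : ℕ) * Real.log (f t)))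

theorem lintegral_ofReal_exp_ne_zero {X : Type*} [MeasurableSpace X] [TopologicalSpace X]
    [BorelSpace X] (μ : Measure X) [NeZero μ] {h : X → ℝ} (hh : Continuous h) :
    ∫⁻ x, ENNReal.ofReal (Real.exp (h x)) ∂μ ≠ 0 := by
  rw [Ne, lintegral_eq_zero_iff (by fun_prop)]
  intro h0
  obtain ⟨x, hx⟩ := h0.exists
  simp only [Pi.zero_apply, ENNReal.ofReal_eq_zero] at hx
  exact (Real.exp_pos _).not_ge hx

theorem integrable_of_continuous_of_compactSpace {X : Type*} [MeasurableSpace X]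
    [TopologicalSpace X] [CompactSpace X] [BorelSpace X] (μ : Measure X) [IsFiniteMeasure μ]
    {h : X → ℝ} (hh : Continuous h) : Integrable h μ :=
  hh.integrable_of_hasCompactSupport (HasCompactSupport.of_compactSpace h)

theorem lintegral_ofReal_exp_ne_top {X : Type*} [MeasurableSpace X] [TopologicalSpace X]
    [CompactSpace X] [BorelSpace X] (μ : Measure X) [IsFiniteMeasure μ] {h : X → ℝ}
    (hh : Continuous h) : ∫⁻ x, ENNReal.ofReal (Real.exp (h x)) ∂μ ≠ ∞ :=
  (integrable_of_continuous_of_compactSpace μ (Real.continuous_exp.comp hh)).lintegral_lt_top.ne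

namespace IsPositiveFixedPoint

variable {V : Type*} [DecidableEq V] {G : SimpleGraph V} [G.LocallyFinite]
  {Φ : Sym2 unitInterval → ℝ} {β : ℝ} {k : ℕ} {f : unitInterval → ℝ}

theorem continuous_log (hf : IsPositiveFixedPoint Φ β k f) :
    Continuous fun t => Real.log (f t) :=
  hf.continuous.log fun t => (hf.pos t).ne'

theorem continuous_pair (hf : IsPositiveFixedPoint Φ β k f) {X : Type*} [TopologicalSpace X]
    {a b : X → unitInterval} (ha : Continuous a) (hb : Continuous b) :
    Continuous fun x => Φ s(a x, b x) :=
  hf.continuous_interaction.comp (ha.prodMk hb)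

theorem continuous_logWeight (hf : IsPositiveFixedPoint Φ β k f) (A : Finset V) :
    Continuous (logWeight G Φ β f A) := by
  refine continuous_finsetSum _ fun x _ => continuous_finsetSum _ fun y _ => ?_
  split_ifs
  · exact continuous_const.mul (hf.continuous_pair (continuous_apply x) (continuous_apply y))
  · exact hf.continuous_log.comp (continuous_apply x)

theorem totalMass_ne_zero (hf : IsPositiveFixedPoint Φ β k f) : totalMass k f ≠ 0 :=
  lintegral_ofReal_exp_ne_zero _ (continuous_const.mul hf.continuous_log)

theorem totalMass_ne_top (hf : IsPositiveFixedPoint Φ β k f) : totalMass k f ≠ ∞ :=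
  lintegral_ofReal_exp_ne_top _ (continuous_const.mul hf.continuous_log)

theorem measurable_weight [Countable V] (hf : IsPositiveFixedPoint Φ β k f) (A : Finset V) :
    Measurable (weight G Φ β f A) :=
  ENNReal.measurable_ofReal.comp
    (Real.measurable_exp.comp (hf.continuous_logWeight A).measurable)

end IsPositiveFixedPoint

theorem logWeight_singleton {V : Type*} [DecidableEq V] (G : SimpleGraph V) [G.LocallyFinite]
    (Φ : Sym2 unitInterval → ℝ) (β : ℝ) (f : unitInterval → ℝ) (x : V) (σ : V → unitInterval) :
    logWeight G Φ β f {x} σ = G.degree x * Real.log (f (σ x)) := by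
  rw [logWeight, Finset.sum_singleton, Finset.sum_congr rfl (g := fun _ => Real.log (f (σ x)))]
  · simp
  · intro y hy
    rw [SimpleGraph.mem_neighborFinset] at hy
    simp [hy.ne']

theorem dependsOn_logWeight {V : Type*} [DecidableEq V] (G : SimpleGraph V) [G.LocallyFinite]
    (Φ : Sym2 unitInterval → ℝ) (β : ℝ) (f : unitInterval → ℝ) (A : Finset V) :
    DependsOn (logWeight G Φ β f A) (A : Set V) := by
  intro σ τ h
  refine Finset.sum_congr rfl fun x hx => Finset.sum_congr rfl fun y _ => ?_
  split_ifs with hy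
  · rw [h x hx, h y hy]
  · rw [h x hx]

/-- Effect on the density of adding a leaf `y` to a finite set. -/
theorem logWeight_insert_update {V : Type*} [DecidableEq V] (G : SimpleGraph V) [G.LocallyFinite]
    (Φ : Sym2 unitInterval → ℝ) (β : ℝ) (f : unitInterval → ℝ) {k : ℕ} {A : Finset V} {x y : V}
    (hk : G.degree y = k + 1) (hx : x ∈ A) (hy : y ∉ A) (hxy : G.Adj x y)
    (huniq : ∀ z ∈ A, G.Adj y z → z = x) (σ : V → unitInterval) (u : unitInterval) :
    logWeight G Φ β f (insert y A) (Function.update σ y u) =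
      logWeight G Φ β f A σ - Real.log (f (σ x)) + (-β * Φ s(σ x, u) + k * Real.log (f u)) := by
  set τ := Function.update σ y u with hτ
  have hτy : τ y = u := by simp [hτ]
  have hτA : ∀ z ∈ A, τ z = σ z := fun z hz => by
    rw [hτ, Function.update_of_ne]
    rintro rfl
    exact hy hz
  rw [logWeight, Finset.sum_insert hy]
  -- the edges at the new vertex
  have h1 : (∑ z ∈ G.neighborFinset y,
      if z ∈ insert y A then -β / 2 * Φ s(τ y, τ z) else Real.log (f (τ y))) =
      -β / 2 * Φ s(σ x, u) + k * Real.log (f u) := by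
    have hxN : x ∈ G.neighborFinset y := by simpa using hxy.symm
    rw [← Finset.add_sum_erase _ _ hxN, if_pos (Finset.mem_insert_of_mem hx), hτy, hτA x hx,
      Sym2.eq_swap, Finset.sum_congr rfl (g := fun _ => Real.log (f u))]
    · rw [Finset.sum_const, Finset.card_erase_of_mem hxN, SimpleGraph.card_neighborFinset_eq_degree,
        hk, nsmul_eq_mul, Nat.add_sub_cancel]
    · intro z hz
      rw [Finset.mem_erase, SimpleGraph.mem_neighborFinset] at hz
      rw [if_neg]
      rw [Finset.mem_insert]
      rintro (rfl | h)
      · exact hz.2.ne rfl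
      · exact hz.1 (huniq z h hz.2)
  -- the edges at old vertices: only the edge from `x` to `y` changes
  have h2 : (∑ z ∈ A, ∑ w ∈ G.neighborFinset z,
      if w ∈ insert y A then -β / 2 * Φ s(τ z, τ w) else Real.log (f (τ z))) =
      logWeight G Φ β f A σ + (-β / 2 * Φ s(σ x, u) - Real.log (f (σ x))) := by
    rw [← sub_eq_iff_eq_add', logWeight, ← Finset.sum_sub_distrib, Finset.sum_eq_single_of_mem x hx]
    · rw [← Finset.sum_sub_distrib, Finset.sum_eq_single_of_mem y (by simpa using hxy)]
      · rw [if_pos (Finset.mem_insert_self _ _), if_neg hy, hτA x hx, hτy]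
      · intro w _ hwy
        rw [hτA x hx]
        by_cases hw : w ∈ A
        · rw [if_pos (Finset.mem_insert_of_mem hw), if_pos hw, hτA w hw, sub_self]
        · rw [if_neg (by simp [hwy, hw]), if_neg hw, sub_self]
    · intro z hz hzx
      rw [sub_eq_zero]
      refine Finset.sum_congr rfl fun w hw => ?_
      rw [SimpleGraph.mem_neighborFinset] at hw
      have hwy : w ≠ y := by
        rintro rfl
        exact hzx (huniq z hz hw.symm)
      rw [hτA z hz]
      by_cases hwA : w ∈ A
      · rw [if_pos (Finset.mem_insert_of_mem hwA), if_pos hwA, hτA w hwA]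
      · rw [if_neg (by simp [hwy, hwA]), if_neg hwA]
  rw [h1, h2]
  ring

theorem lmarginal_eq_lmarginal_sdiff {V : Type*} [DecidableEq V] {A B : Finset V} (hAB : A ⊆ B)
    {F : (V → unitInterval) → ℝ≥0∞} (hF : Measurable F) :
    (∫⋯∫⁻_B, F) = ∫⋯∫⁻_A, ∫⋯∫⁻_B \ A, F := by
  rw [← lmarginal_union _ _ hF Finset.disjoint_sdiff, Finset.union_sdiff_of_subset hAB]

namespace IsPositiveFixedPoint

variable {V : Type*} [DecidableEq V] {G : SimpleGraph V} [G.LocallyFinite]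
  {Φ : Sym2 unitInterval → ℝ} {β : ℝ} {k : ℕ} {f : unitInterval → ℝ}

/-- Integrating out the spin at a leaf: this is the fixed point equation. -/
theorem lintegral_weight_insert (hf : IsPositiveFixedPoint Φ β k f) {A : Finset V} {x y : V}
    (hk : G.degree y = k + 1) (hx : x ∈ A) (hy : y ∉ A) (hxy : G.Adj x y)
    (huniq : ∀ z ∈ A, G.Adj y z → z = x) (σ : V → unitInterval) :
    ∫⁻ u, weight G Φ β f (insert y A) (Function.update σ y u) = weight G Φ β f A σ := by
  have key : ∀ u, weight G Φ β f (insert y A) (Function.update σ y u) =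
      ENNReal.ofReal (Real.exp (logWeight G Φ β f A σ - Real.log (f (σ x)))) *
        ENNReal.ofReal (kernel Φ β (σ x) u * f u ^ k) := fun u => by
    rw [weight, logWeight_insert_update G Φ β f hk hx hy hxy huniq, Real.exp_add,
      ENNReal.ofReal_mul (Real.exp_nonneg _), Real.exp_add, kernel, Real.exp_nat_mul,
      Real.exp_log (hf.pos u)]
  have hcont : Continuous fun u => kernel Φ β (σ x) u * f u ^ k :=
    (Real.continuous_exp.comp
      (continuous_const.mul (hf.continuous_pair continuous_const continuous_id))).mul
      (hf.continuous.pow k)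
  simp_rw [key]
  rw [lintegral_const_mul _ hcont.measurable.ennreal_ofReal, ← ofReal_integral_eq_lintegral_ofReal
    (integrable_of_continuous_of_compactSpace _ hcont)
    (.of_forall fun u => mul_nonneg (Real.exp_nonneg _) (pow_nonneg (hf.pos u).le _))]
  have := hf.fixed (σ x)
  rw [hammerstein] at this
  rw [this, ← ENNReal.ofReal_mul (Real.exp_nonneg _), Real.exp_sub, Real.exp_log (hf.pos _),
    div_mul_cancel₀ _ (hf.pos _).ne', weight]

/-- Consistency: the density on a finite subtree is the marginal of the density on any larger
one. -/
theorem lmarginal_sdiff_weight (hf : IsPositiveFixedPoint Φ β k f) (hG : IsCayleyTree G k)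
    {A B : Finset V} (hAB : A ⊆ B) (hA : (G.induce (A : Set V)).Connected)
    (hB : (G.induce (B : Set V)).Connected) :
    (∫⋯∫⁻_B \ A, weight G Φ β f B) = weight G Φ β f A := by
  have := countable_of_connected G hG.1.connected
  refine subtree_induction hB (P := fun A => (∫⋯∫⁻_B \ A, weight G Φ β f B) = weight G Φ β f A)
    ?_ ?_ A hAB hA
  · simp
  · intro A hAB hA x hx y hy hyA hxy ih
    have hsd : B \ A = insert y (B \ insert y A) := by
      rw [Finset.sdiff_insert, Finset.insert_erase (Finset.mem_sdiff.2 ⟨hy, hyA⟩)]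
    ext σ
    rw [hsd, lmarginal_insert _ (hf.measurable_weight B) (by simp), ih]
    exact hf.lintegral_weight_insert (hG.2 y) hx hyA hxy (fun z hz hyz =>
      eq_of_adj_of_induce_preconnected hG.1.isAcyclic hA.preconnected hz hx hyA hyz hxy.symm) σ

theorem lmarginal_weight (hf : IsPositiveFixedPoint Φ β k f) (hG : IsCayleyTree G k)
    {A : Finset V} (hA : (G.induce (A : Set V)).Connected) (σ : V → unitInterval) :
    (∫⋯∫⁻_A, weight G Φ β f A) σ = totalMass k f := by
  have := countable_of_connected G hG.1.connected
  obtain ⟨x, hx⟩ := hA.nonempty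
  have hxA : {x} ⊆ A := Finset.singleton_subset_iff.2 hx
  rw [lmarginal_eq_lmarginal_sdiff hxA (hf.measurable_weight A),
    hf.lmarginal_sdiff_weight hG hxA _ hA, lmarginal_singleton]
  · simp [weight, logWeight_singleton, hG.2 x, totalMass]
  · rw [Finset.coe_singleton]
    exact induce_singleton_connected G x

end IsPositiveFixedPoint

theorem lmarginal_mul_left {V : Type*} [DecidableEq V] {A : Finset V}
    {g h : (V → unitInterval) → ℝ≥0∞} (hg : DependsOn g (A : Set V)ᶜ) (hh : Measurable h) :
    (∫⋯∫⁻_A, (fun σ => g σ * h σ)) = fun σ => g σ * (∫⋯∫⁻_A, h) σ := by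
  ext σ
  rw [lmarginal, lmarginal, ← lintegral_const_mul (g σ)
    (f := fun s => h (Function.updateFinset σ A s)) (hh.comp measurable_updateFinset)]
  refine lintegral_congr fun s => ?_
  congr 1
  refine hg fun x hx => ?_
  simp only [Set.mem_compl_iff, Finset.mem_coe] at hx
  simp [Function.updateFinset, hx]

/-- Consistency, in integrated form. -/
theorem IsPositiveFixedPoint.lmarginal_mul_weight_of_subset {V : Type*} [DecidableEq V]
    {G : SimpleGraph V} [G.LocallyFinite] {Φ : Sym2 unitInterval → ℝ} {β : ℝ} {k : ℕ}
    {f : unitInterval → ℝ} (hf : IsPositiveFixedPoint Φ β k f) (hG : IsCayleyTree G k)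
    {A B : Finset V} (hAB : A ⊆ B) (hA : (G.induce (A : Set V)).Connected)
    (hB : (G.induce (B : Set V)).Connected) {F : (V → unitInterval) → ℝ≥0∞} (hF : Measurable F)
    (hFA : DependsOn F (A : Set V)) :
    (∫⋯∫⁻_B, (fun σ => F σ * weight G Φ β f B σ)) =
      ∫⋯∫⁻_A, (fun σ => F σ * weight G Φ β f A σ) := by
  have := countable_of_connected G hG.1.connected
  rw [lmarginal_eq_lmarginal_sdiff (F := fun σ => F σ * weight G Φ β f B σ) hAB
    (hF.mul (hf.measurable_weight B)), lmarginal_mul_left (A := B \ A) ?_ (hf.measurable_weight _),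
    hf.lmarginal_sdiff_weight hG hAB hA hB]
  intro σ τ h
  refine hFA fun x hx => h x ?_
  simp [Finset.mem_coe.1 hx]

/-! ### The measure with given densities on subtrees -/

theorem dependsOn_indicator_preimage_restrict {V : Type*} (A : Finset V)
    (S : Set (A → unitInterval)) :
    DependsOn ((A.restrict ⁻¹' S).indicator (1 : (V → unitInterval) → ℝ≥0∞)) (A : Set V) := by
  intro σ τ h
  have hr : A.restrict σ = A.restrict τ := funext fun x => h x x.2
  have hiff : σ ∈ A.restrict ⁻¹' S ↔ τ ∈ A.restrict ⁻¹' S := by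
    rw [Set.mem_preimage, Set.mem_preimage, hr]
  classical
  rw [Set.indicator_apply, Set.indicator_apply]
  exact if_congr hiff rfl rfl

theorem lmarginal_eq_of_dependsOn {V : Type*} [DecidableEq V] {A : Finset V}
    {F : (V → unitInterval) → ℝ≥0∞} (hF : DependsOn F (A : Set V)) (σ τ : V → unitInterval) :
    (∫⋯∫⁻_A, F) σ = (∫⋯∫⁻_A, F) τ := by
  refine lintegral_congr fun s => hF fun x hx => ?_
  simp [Function.updateFinset, Finset.mem_coe.1 hx]

/-- `μ` is a probability measure whose marginal on every finite subtree `A` has density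
`weight A / totalMass`. This is stated by integrating functions of the configuration on `A`; the
integral over the spins in `A` does not depend on the configuration `σ` outside `A`. -/
structure HasSubtreeDensities {V : Type*} [DecidableEq V] (G : SimpleGraph V) [G.LocallyFinite]
    (Φ : Sym2 unitInterval → ℝ) (β : ℝ) (k : ℕ) (f : unitInterval → ℝ)
    (μ : Measure (V → unitInterval)) : Prop where
  isProbabilityMeasure : IsProbabilityMeasure μ
  lintegral_mul_totalMass : ∀ A : Finset V, (G.induce (A : Set V)).Connected →
    ∀ F : (V → unitInterval) → ℝ≥0∞, Measurable F → DependsOn F (A : Set V) → ∀ σ,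
      (∫⁻ τ, F τ ∂μ) * totalMass k f = (∫⋯∫⁻_A, (fun τ => F τ * weight G Φ β f A τ)) σ

/-- The distribution with density `weight A / totalMass` on the finite set `A`, extended by the
constant configuration `0` outside `A`. -/
def subtreeMeasure {V : Type*} [DecidableEq V] (G : SimpleGraph V) [G.LocallyFinite]
    (Φ : Sym2 unitInterval → ℝ) (β : ℝ) (k : ℕ) (f : unitInterval → ℝ) (A : Finset V) :
    Measure (V → unitInterval) :=
  (totalMass k f)⁻¹ • ((aPriori A).withDensity fun s =>
    weight G Φ β f A (Function.updateFinset (0 : V → unitInterval) A s)).map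
      (Function.updateFinset (0 : V → unitInterval) A)

theorem lintegral_subtreeMeasure {V : Type*} [DecidableEq V] {G : SimpleGraph V} [G.LocallyFinite]
    [Countable V] {Φ : Sym2 unitInterval → ℝ} {β : ℝ} {k : ℕ} {f : unitInterval → ℝ}
    (hf : IsPositiveFixedPoint Φ β k f) (A : Finset V)
    {F : (V → unitInterval) → ℝ≥0∞} (hF : Measurable F) :
    ∫⁻ τ, F τ ∂(subtreeMeasure G Φ β k f A) =
      (totalMass k f)⁻¹ * (∫⋯∫⁻_A, (fun τ => F τ * weight G Φ β f A τ)) 0 := by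
  rw [subtreeMeasure, lintegral_smul_measure, lintegral_map hF measurable_updateFinset,
    lintegral_withDensity_eq_lintegral_mul (aPriori A)
      (f := fun s => weight G Φ β f A (Function.updateFinset (0 : V → unitInterval) A s))
      ((hf.measurable_weight A).comp measurable_updateFinset)
      (g := fun s => F (Function.updateFinset (0 : V → unitInterval) A s))
      (hF.comp measurable_updateFinset), smul_eq_mul, lmarginal, aPriori]
  congr 1
  exact lintegral_congr fun s => mul_comm _ _

theorem isProbabilityMeasure_subtreeMeasure {V : Type*} [DecidableEq V] {G : SimpleGraph V}
    [G.LocallyFinite] {Φ : Sym2 unitInterval → ℝ} {β : ℝ} {k : ℕ} {f : unitInterval → ℝ}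
    (hf : IsPositiveFixedPoint Φ β k f) (hG : IsCayleyTree G k) {A : Finset V}
    (hA : (G.induce (A : Set V)).Connected) :
    IsProbabilityMeasure (subtreeMeasure G Φ β k f A) := by
  have := countable_of_connected G hG.1.connected
  constructor
  rw [← lintegral_one, lintegral_subtreeMeasure hf A measurable_const]
  simp_rw [one_mul]
  rw [hf.lmarginal_weight hG hA,
    ENNReal.inv_mul_cancel hf.totalMass_ne_zero hf.totalMass_ne_top]

theorem lintegral_map_restrict_of_dependsOn {V : Type*} [DecidableEq V] {A : Finset V}
    (μ : Measure (V → unitInterval)) {F : (V → unitInterval) → ℝ≥0∞} (hF : Measurable F)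
    (hFA : DependsOn F (A : Set V)) :
    ∫⁻ s, F (Function.updateFinset (0 : V → unitInterval) A s) ∂(μ.map A.restrict) = ∫⁻ τ, F τ ∂μ := by
  rw [lintegral_map (f := fun s => F (Function.updateFinset (0 : V → unitInterval) A s))
    (hF.comp measurable_updateFinset) (Finset.measurable_restrict A)]
  refine lintegral_congr fun τ => hFA fun x hx => ?_
  simp [Function.updateFinset, Finset.mem_coe.1 hx]

/-- The measure is a limit point of the finite volume distributions on balls, whose marginals on a
given finite set are eventually constant. -/
theorem exists_hasSubtreeDensities {V : Type*} [DecidableEq V] {G : SimpleGraph V}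
    [G.LocallyFinite] {Φ : Sym2 unitInterval → ℝ} {β : ℝ} {k : ℕ} {f : unitInterval → ℝ}
    (hf : IsPositiveFixedPoint Φ β k f) (hG : IsCayleyTree G k) :
    ∃ μ, HasSubtreeDensities G Φ β k f μ := by
  have := countable_of_connected G hG.1.connected
  obtain ⟨x₀⟩ := hG.1.connected.nonempty
  have hball := induce_ball_connected G hG.1.connected x₀
  let ν : ℕ → ProbabilityMeasure (V → unitInterval) := fun n =>
    ⟨subtreeMeasure G Φ β k f (ball G x₀ n), isProbabilityMeasure_subtreeMeasure hf hG (hball n)⟩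
  let U : Ultrafilter ℕ := Ultrafilter.of Filter.atTop
  obtain ⟨μ, hμ⟩ : ∃ μ, Filter.Tendsto ν U (nhds μ) := ⟨_, (U.map ν).le_nhds_lim⟩
  refine ⟨μ, inferInstance, fun A hA F hF hFA σ => ?_⟩
  obtain ⟨n₀, -, hn₀⟩ := exists_subset_ball G hG.1.connected x₀ A
  have hν : ∀ n, n₀ ≤ n → ∀ F : (V → unitInterval) → ℝ≥0∞, Measurable F →
      DependsOn F (A : Set V) → ∫⁻ τ, F τ ∂(ν n : Measure (V → unitInterval)) =
        (totalMass k f)⁻¹ * (∫⋯∫⁻_A, (fun τ => F τ * weight G Φ β f A τ)) 0 := by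
    intro n hn F hF hFA
    rw [ProbabilityMeasure.coe_mk, lintegral_subtreeMeasure hf _ hF,
      hf.lmarginal_mul_weight_of_subset hG (hn₀.trans (ball_mono G hG.1.connected x₀ hn)) hA
        (hball n) hF hFA]
  have hcont : Continuous (A.restrict : (V → unitInterval) → A → unitInterval) :=
    A.continuous_restrict
  have hmap : ∀ n, n₀ ≤ n → (ν n).map hcont.measurable.aemeasurable =
      (ν n₀).map hcont.measurable.aemeasurable := by
    intro n hn
    apply ProbabilityMeasure.toMeasure_injective
    rw [ProbabilityMeasure.toMeasure_map, ProbabilityMeasure.toMeasure_map]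
    ext S hS
    have hS' : MeasurableSet (A.restrict ⁻¹' S : Set (V → unitInterval)) := hcont.measurable hS
    rw [Measure.map_apply hcont.measurable hS, Measure.map_apply hcont.measurable hS,
      ← lintegral_indicator_one hS', ← lintegral_indicator_one hS']
    have hdep := dependsOn_indicator_preimage_restrict A S
    rw [hν n hn _ (measurable_one.indicator hS') hdep,
      hν n₀ le_rfl _ (measurable_one.indicator hS') hdep]
  have hlim := ProbabilityMeasure.tendsto_map_of_tendsto_of_continuous ν μ hμ hcont
  have heq : μ.map hcont.measurable.aemeasurable = (ν n₀).map hcont.measurable.aemeasurable := by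
    refine tendsto_nhds_unique hlim (tendsto_const_nhds.congr' ?_)
    have : ∀ᶠ n in (U : Filter ℕ), n₀ ≤ n :=
      Ultrafilter.of_le _ (Filter.eventually_ge_atTop n₀)
    filter_upwards [this] with n hn using (hmap n hn).symm
  have heq' := congrArg (fun ρ : ProbabilityMeasure _ => (ρ : Measure (A → unitInterval))) heq
  simp only [ProbabilityMeasure.toMeasure_map] at heq'
  rw [← lintegral_map_restrict_of_dependsOn (A := A) _ hF hFA, heq',
    lintegral_map_restrict_of_dependsOn _ hF hFA, hν n₀ le_rfl F hF hFA, mul_comm,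
    ← mul_assoc, ENNReal.mul_inv_cancel hf.totalMass_ne_zero hf.totalMass_ne_top, one_mul]
  refine lmarginal_eq_of_dependsOn (fun σ τ h => ?_) _ _
  rw [hFA h, weight, weight, dependsOn_logWeight G Φ β f A h]

theorem ext_of_ball {V : Type*} {G : SimpleGraph V} [G.LocallyFinite] (hG : G.Connected) (x₀ : V)
    {μ ν : Measure (V → unitInterval)} [IsProbabilityMeasure μ] [IsProbabilityMeasure ν]
    (h : ∀ n, 1 ≤ n → ∀ S : Set (ball G x₀ n → unitInterval), MeasurableSet S →
      μ ((ball G x₀ n).restrict ⁻¹' S) = ν ((ball G x₀ n).restrict ⁻¹' S)) : μ = ν := by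
  have : ∀ J : Finset V, IsFiniteMeasure (ν.map (J.restrict (π := fun _ => unitInterval))) :=
    fun J => Measure.isFiniteMeasure_map _ _
  refine IsProjectiveLimit.unique (P := fun J => ν.map J.restrict) (fun J => ?_) fun J => rfl
  obtain ⟨n, hn, hJ⟩ := exists_subset_ball G hG x₀ J
  ext S hS
  rw [Measure.map_apply (Finset.measurable_restrict J) hS,
    Measure.map_apply (Finset.measurable_restrict J) hS]
  exact h n hn (Finset.restrict₂ (π := fun _ => unitInterval) hJ ⁻¹' S)
    (Finset.measurable_restrict₂ (X := fun _ => unitInterval) hJ hS)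

theorem HasSubtreeDensities.unique {V : Type*} [DecidableEq V] {G : SimpleGraph V}
    [G.LocallyFinite] {Φ : Sym2 unitInterval → ℝ} {β : ℝ} {k : ℕ} {f : unitInterval → ℝ}
    (hf : IsPositiveFixedPoint Φ β k f) (hG : G.Connected) {μ ν : Measure (V → unitInterval)}
    (hμ : HasSubtreeDensities G Φ β k f μ) (hν : HasSubtreeDensities G Φ β k f ν) : μ = ν := by
  obtain ⟨x₀⟩ := hG.nonempty
  have := hμ.isProbabilityMeasure
  have := hν.isProbabilityMeasure
  refine ext_of_ball hG x₀ fun n _ S hS => ?_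
  have hS' := Finset.measurable_restrict (X := fun _ => unitInterval) (ball G x₀ n) hS
  rw [← lintegral_indicator_one hS', ← lintegral_indicator_one hS',
    ← ENNReal.mul_left_inj hf.totalMass_ne_zero hf.totalMass_ne_top,
    hμ.lintegral_mul_totalMass _ (induce_ball_connected G hG x₀ n) _
      (measurable_one.indicator hS') (dependsOn_indicator_preimage_restrict _ S) 0,
    hν.lintegral_mul_totalMass _ (induce_ball_connected G hG x₀ n) _
      (measurable_one.indicator hS') (dependsOn_indicator_preimage_restrict _ S) 0]

theorem logWeight_image {V : Type*} [DecidableEq V] {G : SimpleGraph V}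
    [G.LocallyFinite] (Φ : Sym2 unitInterval → ℝ) (β : ℝ) (f : unitInterval → ℝ)
    (φ : G ≃g G) (A : Finset V) (σ : V → unitInterval) :
    logWeight G Φ β f (A.image φ) σ = logWeight G Φ β f A (fun x => σ (φ x)) := by
  rw [logWeight, Finset.sum_image φ.injective.injOn]
  refine Finset.sum_congr rfl fun x _ => ?_
  have : G.neighborFinset (φ x) = (G.neighborFinset x).image φ := by
    ext y
    simp only [SimpleGraph.mem_neighborFinset, Finset.mem_image]
    constructor
    · intro h
      refine ⟨φ.symm y, ?_, by simp⟩
      rw [← φ.map_adj_iff]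
      simpa using h
    · rintro ⟨z, hz, rfl⟩
      exact φ.map_adj_iff.2 hz
  rw [this, Finset.sum_image φ.injective.injOn]
  refine Finset.sum_congr rfl fun y _ => ?_
  simp [φ.injective.mem_finset_image]

/-- The densities on subtrees are invariant under automorphisms, hence so is the measure that they
determine. -/
theorem HasSubtreeDensities.isTranslationInvariant {V : Type*} [DecidableEq V] {G : SimpleGraph V}
    [G.LocallyFinite] {Φ : Sym2 unitInterval → ℝ} {β : ℝ} {k : ℕ} {f : unitInterval → ℝ}
    (hf : IsPositiveFixedPoint Φ β k f) (hG : G.Connected) {μ : Measure (V → unitInterval)}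
    (hμ : HasSubtreeDensities G Φ β k f μ) : IsTranslationInvariant G μ := by
  intro φ
  have := countable_of_connected G hG
  have := hμ.isProbabilityMeasure
  have hφ : Measurable fun (σ : V → unitInterval) (x : V) => σ (φ x) := by fun_prop
  refine HasSubtreeDensities.unique hf hG ⟨Measure.isProbabilityMeasure_map hφ.aemeasurable, ?_⟩ hμ
  intro A hA F hF hFA σ
  have hA' : (G.induce (A.image φ : Set V)).Connected := by
    rw [Finset.coe_image]
    exact (SimpleGraph.Iso.connected_iff (φ.induce (φ.injective.injOn.bijOn_image (s := (A : Set V))))).1 hA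
  rw [lintegral_map hF hφ, hμ.lintegral_mul_totalMass (A.image φ) hA' (fun τ => F fun x => τ (φ x))
    (hF.comp hφ) ?_ (fun x => σ (φ.symm x))]
  · have himage : (∫⋯∫⁻_A.image φ, (fun τ => (F * weight G Φ β f A) fun x => τ (φ x)))
        (fun x => σ (φ.symm x)) =
        (∫⋯∫⁻_A, F * weight G Φ β f A) (fun x => σ (φ.symm (φ x))) :=
      lmarginal_image (μ := fun _ : V => (volume : Measure unitInterval)) φ.injective A
        (hF.mul (hf.measurable_weight (G := G) A)) (fun x => σ (φ.symm x))
    simp only [RelIso.symm_apply_apply] at himage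
    refine Eq.trans ?_ himage
    congr 1
    ext τ
    simp [weight, logWeight_image]
  · intro τ τ' h
    refine hFA fun x hx => h (φ x) ?_
    simpa using hx

/-! ### The DLR equations -/

theorem two_mul_energy {V : Type*} [DecidableEq V] (G : SimpleGraph V) [G.LocallyFinite]
    (Φ : Sym2 unitInterval → ℝ) (Λ : Finset V) (σ : V → unitInterval) :
    2 * energy G Φ Λ (Λ.restrict σ) =
      ∑ x ∈ Λ, ∑ y ∈ G.neighborFinset x, if y ∈ Λ then Φ s(σ x, σ y) else 0 := by
  classical
  set H := G.comap (Subtype.val : Λ → V)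
  set F : Sym2 Λ → ℝ := fun e => Φ (e.map (Λ.restrict σ))
  have h1 : ∑ d : H.Dart, F d.edge = 2 * energy G Φ Λ (Λ.restrict σ) := by
    rw [energy, Finset.mul_sum,
      ← Finset.sum_fiberwise_of_maps_to (t := H.edgeFinset) (g := SimpleGraph.Dart.edge)
      (fun d _ => by simp)]
    refine Finset.sum_congr (by congr!) fun e he => ?_
    rw [Finset.sum_congr rfl (g := fun _ => F e)
      (fun d hd => by rw [(Finset.mem_filter.1 hd).2]), Finset.sum_const,
      H.dart_edge_fiber_card e (by simpa using he), nsmul_eq_mul]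
    simp [F]
  have h2 : ∑ d : H.Dart, F d.edge = ∑ p : Λ × Λ with H.Adj p.1 p.2, Φ s(σ p.1, σ p.2) := by
    refine Finset.sum_bij' (fun d _ => d.toProd) (fun p hp => ⟨p, (Finset.mem_filter.1 hp).2⟩)
      ?_ ?_ ?_ ?_ ?_
    · intro d _
      simp
    · simp
    · simp
    · simp
    · intro d _
      rfl
  rw [← h1, h2, Finset.sum_filter, Fintype.sum_prod_type, ← Finset.sum_coe_sort Λ]
  refine Finset.sum_congr rfl fun x _ => ?_
  rw [← Finset.sum_filter, ← Finset.sum_filter]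
  refine Finset.sum_bij (fun y _ => (y : V)) ?_ ?_ ?_ ?_
  · intro y hy
    simpa [H] using hy
  · intro a _ b _ h
    exact Subtype.ext h
  · intro b hb
    simp only [Finset.mem_filter, SimpleGraph.mem_neighborFinset] at hb
    exact ⟨⟨b, hb.2⟩, by simpa [H] using hb.1, rfl⟩
  · intro y _
    rfl

theorem boundaryEnergy_restrict {V : Type*} [DecidableEq V] (G : SimpleGraph V) [G.LocallyFinite]
    (Φ : Sym2 unitInterval → ℝ) (Λ : Finset V) (σ ω : V → unitInterval) :
    boundaryEnergy G Φ Λ (Λ.restrict σ) ω =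
      ∑ x ∈ Λ, ∑ y ∈ G.neighborFinset x, if y ∈ Λ then 0 else Φ s(σ x, ω y) := by
  rw [boundaryEnergy, ← Finset.sum_coe_sort Λ]
  refine Finset.sum_congr rfl fun x _ => ?_
  rw [Finset.sum_filter]
  refine Finset.sum_congr rfl fun y _ => ?_
  by_cases hy : y ∈ Λ <;> simp [hy]

/-- If `A` contains `Λ` and its neighbours, then the density on `A` is the product of the Boltzmann
weight of `Λ` and a function of the spins outside `Λ`. -/
theorem exists_weight_eq_mul {V : Type*} [DecidableEq V] (G : SimpleGraph V) [G.LocallyFinite]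
    (Φ : Sym2 unitInterval → ℝ) (β : ℝ) (f : unitInterval → ℝ) {Λ A : Finset V} (hΛ : Λ ⊆ A)
    (hN : ∀ x ∈ Λ, G.neighborFinset x ⊆ A) :
    ∃ R : (V → unitInterval) → ℝ≥0∞, DependsOn R (Λ : Set V)ᶜ ∧
      ∀ σ, weight G Φ β f A σ = R σ * gibbsWeight G Φ β Λ σ (Λ.restrict σ) := by
  let r : (V → unitInterval) → ℝ := fun σ => ∑ x ∈ A \ Λ, ∑ y ∈ G.neighborFinset x,
    if y ∈ Λ then 0 else if y ∈ A then -β / 2 * Φ s(σ x, σ y) else Real.log (f (σ x))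
  refine ⟨fun σ => ENNReal.ofReal (Real.exp (r σ)), ?_, fun σ => ?_⟩
  · intro σ τ h
    have : r σ = r τ := by
      refine Finset.sum_congr rfl fun x hx => Finset.sum_congr rfl fun y _ => ?_
      have hx' : σ x = τ x := h x (by simpa using (Finset.mem_sdiff.1 hx).2)
      by_cases hy : y ∈ Λ
      · simp [hy]
      · rw [if_neg hy, if_neg hy, hx', h y (by simpa using hy)]
    simp only [this]
  · rw [weight, gibbsWeight, ← ENNReal.ofReal_mul (Real.exp_nonneg _), ← Real.exp_add]
    congr 2
    have hin : (∑ x ∈ Λ, ∑ y ∈ G.neighborFinset x,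
        if y ∈ A then -β / 2 * Φ s(σ x, σ y) else Real.log (f (σ x))) =
        -β / 2 * (2 * energy G Φ Λ (Λ.restrict σ) + boundaryEnergy G Φ Λ (Λ.restrict σ) σ) := by
      rw [two_mul_energy, boundaryEnergy_restrict, ← Finset.sum_add_distrib, Finset.mul_sum]
      refine Finset.sum_congr rfl fun x hx => ?_
      rw [← Finset.sum_add_distrib, Finset.mul_sum]
      refine Finset.sum_congr rfl fun y hy => ?_
      rw [if_pos (hN x hx hy)]
      by_cases hy : y ∈ Λ <;> simp [hy]
    -- an edge between `Λ` and its complement, seen from its endpoint outside `Λ`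
    have hout : (∑ x ∈ A \ Λ, ∑ y ∈ G.neighborFinset x,
        if y ∈ Λ then -β / 2 * Φ s(σ x, σ y) else 0) =
        -β / 2 * boundaryEnergy G Φ Λ (Λ.restrict σ) σ := by
      rw [boundaryEnergy_restrict, Finset.mul_sum]
      have hcompl : ∀ x ∈ Λ, (-β / 2 * ∑ y ∈ G.neighborFinset x,
          if y ∈ Λ then 0 else Φ s(σ x, σ y)) =
          ∑ y ∈ G.neighborFinset x with y ∉ Λ, -β / 2 * Φ s(σ x, σ y) := fun x _ => by
        rw [Finset.sum_filter, Finset.mul_sum]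
        refine Finset.sum_congr rfl fun y _ => ?_
        by_cases hy : y ∈ Λ <;> simp [hy]
      rw [Finset.sum_congr rfl hcompl]
      simp_rw [← Finset.sum_filter]
      rw [Finset.sum_comm' (t' := Λ)
        (s' := fun y => (G.neighborFinset y).filter fun x => x ∉ Λ)]
      · refine Finset.sum_congr rfl fun y _ => Finset.sum_congr rfl fun x _ => ?_
        rw [Sym2.eq_swap]
      · intro x y
        simp only [Finset.mem_sdiff, Finset.mem_filter, SimpleGraph.mem_neighborFinset]
        constructor
        · rintro ⟨⟨-, hx⟩, hxy, hy⟩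
          exact ⟨⟨hxy.symm, hx⟩, hy⟩
        · rintro ⟨⟨hxy, hx⟩, hy⟩
          exact ⟨⟨hN y hy (by simpa using hxy), hx⟩, hxy.symm, hy⟩
    have hsplit : (∑ x ∈ A \ Λ, ∑ y ∈ G.neighborFinset x,
        if y ∈ A then -β / 2 * Φ s(σ x, σ y) else Real.log (f (σ x))) =
        r σ + -β / 2 * boundaryEnergy G Φ Λ (Λ.restrict σ) σ := by
      rw [← hout, ← Finset.sum_add_distrib]
      refine Finset.sum_congr rfl fun x _ => ?_
      rw [← Finset.sum_add_distrib]
      refine Finset.sum_congr rfl fun y _ => ?_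
      by_cases hy : y ∈ Λ
      · simp [hy, hΛ hy]
      · simp [hy]
    rw [logWeight, ← Finset.sum_sdiff hΛ, hin, hsplit]
    ring

theorem gibbsWeight_restrict_updateFinset {V : Type*} [DecidableEq V] (G : SimpleGraph V)
    [G.LocallyFinite] (Φ : Sym2 unitInterval → ℝ) (β : ℝ) (Λ : Finset V) (ω : V → unitInterval)
    (s : Λ → unitInterval) :
    gibbsWeight G Φ β Λ (Function.updateFinset ω Λ s)
      (Λ.restrict (Function.updateFinset ω Λ s)) = gibbsWeight G Φ β Λ ω s := by
  rw [Function.restrict_updateFinset]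
  have : boundaryEnergy G Φ Λ s (Function.updateFinset ω Λ s) = boundaryEnergy G Φ Λ s ω := by
    refine Finset.sum_congr rfl fun x _ => Finset.sum_congr rfl fun y hy => ?_
    simp only [Finset.mem_filter] at hy
    simp [Function.updateFinset, hy.2]
  rw [gibbsWeight, this, gibbsWeight]

theorem continuous_energy_add_boundaryEnergy {V : Type*} (G : SimpleGraph V) [G.LocallyFinite]
    {Φ : Sym2 unitInterval → ℝ} (hΦ : Continuous fun p : unitInterval × unitInterval => Φ s(p.1, p.2))
    (β : ℝ) (Λ : Finset V) :
    Continuous fun p : (Λ → unitInterval) × (V → unitInterval) =>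
      -β * (energy G Φ Λ p.1 + boundaryEnergy G Φ Λ p.1 p.2) := by
  have hpair : ∀ a b : (Λ → unitInterval) × (V → unitInterval) → unitInterval, Continuous a →
      Continuous b → Continuous fun p => Φ s(a p, b p) := fun a b ha hb =>
    hΦ.comp (ha.prodMk hb)
  refine continuous_const.mul (Continuous.add ?_ ?_)
  · refine continuous_finsetSum _ fun e _ => ?_
    induction e with
    | _ x y => exact hpair _ _ (by fun_prop) (by fun_prop)
  · exact continuous_finsetSum _ fun x _ => continuous_finsetSum _ fun y _ =>
      hpair _ _ (by fun_prop) (by fun_prop)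

section Specification

variable {V : Type*} {G : SimpleGraph V} [G.LocallyFinite] {Φ : Sym2 unitInterval → ℝ} {β : ℝ}

theorem measurable_gibbsWeight_restrict [Countable V]
    (hΦ : Continuous fun p : unitInterval × unitInterval => Φ s(p.1, p.2)) (Λ : Finset V) :
    Measurable fun σ => gibbsWeight G Φ β Λ σ (Λ.restrict σ) := by
  have hr : Continuous (Λ.restrict : (V → unitInterval) → Λ → unitInterval) :=
    Λ.continuous_restrict
  have := (continuous_energy_add_boundaryEnergy G hΦ β Λ).comp (hr.prodMk continuous_id)
  exact (Real.continuous_exp.comp this).measurable.ennreal_ofReal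

theorem continuous_energy_add_boundaryEnergy_left
    (hΦ : Continuous fun p : unitInterval × unitInterval => Φ s(p.1, p.2)) (Λ : Finset V)
    (ω : V → unitInterval) :
    Continuous fun s => -β * (energy G Φ Λ s + boundaryEnergy G Φ Λ s ω) :=
  (continuous_energy_add_boundaryEnergy G hΦ β Λ).comp (continuous_id.prodMk continuous_const)

instance {Λ : Finset V} : IsProbabilityMeasure (aPriori Λ) := by
  unfold aPriori
  infer_instance

theorem lintegral_gibbsWeight [DecidableEq V] (Λ : Finset V) (ω : V → unitInterval) :
    ∫⁻ s, gibbsWeight G Φ β Λ ω s ∂(aPriori Λ) =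
      (∫⋯∫⁻_Λ, (fun σ => gibbsWeight G Φ β Λ σ (Λ.restrict σ))) ω :=
  lintegral_congr fun s => (gibbsWeight_restrict_updateFinset G Φ β Λ ω s).symm

/-- Conditional Gibbs distributions, as quotients of partial integrals. -/
theorem gibbsSpec_apply [DecidableEq V] [Countable V]
    (hΦ : Continuous fun p : unitInterval × unitInterval => Φ s(p.1, p.2)) (Λ : Finset V)
    (ω : V → unitInterval) {B : Set (V → unitInterval)} (hB : MeasurableSet B) :
    gibbsSpec G Φ β Λ ω {s | glue Λ s ω ∈ B} =
      (∫⋯∫⁻_Λ, (fun σ => B.indicator 1 σ * gibbsWeight G Φ β Λ σ (Λ.restrict σ))) ω /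
        (∫⋯∫⁻_Λ, (fun σ => gibbsWeight G Φ β Λ σ (Λ.restrict σ))) ω := by
  have hglue : ∀ s, glue Λ s ω = Function.updateFinset ω Λ s := fun s => by
    ext x
    by_cases hx : x ∈ Λ <;> simp [glue, Function.updateFinset, hx]
  have hB' : MeasurableSet {s : Λ → unitInterval | glue Λ s ω ∈ B} := by
    simp_rw [hglue]
    exact measurable_updateFinset hB
  rw [gibbsSpec, withDensity_apply _ hB', ← lintegral_gibbsWeight, div_eq_mul_inv, lmarginal,
    ← lintegral_indicator hB', ← lintegral_mul_const]
  · refine lintegral_congr fun s => ?_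
    rw [gibbsWeight_restrict_updateFinset, ← hglue]
    by_cases hs : glue Λ s ω ∈ B
    · rw [Set.indicator_of_mem (show s ∈ {s | glue Λ s ω ∈ B} from hs), Set.indicator_of_mem hs,
        Pi.one_apply, one_mul, div_eq_mul_inv]
    · rw [Set.indicator_of_notMem (show s ∉ {s | glue Λ s ω ∈ B} from hs),
        Set.indicator_of_notMem hs, zero_mul, zero_mul]
  · exact ((measurable_one.indicator hB).mul (measurable_gibbsWeight_restrict hΦ Λ)).comp
      measurable_updateFinset

theorem dependsOn_lmarginal [DecidableEq V] {Λ A : Finset V} {F : (V → unitInterval) → ℝ≥0∞}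
    (hF : DependsOn F (A : Set V)) : DependsOn (∫⋯∫⁻_Λ, F) (A : Set V) := by
  intro σ τ h
  refine lintegral_congr fun s => hF fun x hx => ?_
  by_cases hxΛ : x ∈ Λ <;> simp [Function.updateFinset, hxΛ, h x hx]

theorem dependsOn_gibbsWeight_restrict {Λ A : Finset V} (hΛ : Λ ⊆ A)
    (hN : ∀ x ∈ Λ, G.neighborFinset x ⊆ A) :
    DependsOn (fun σ => gibbsWeight G Φ β Λ σ (Λ.restrict σ)) (A : Set V) := by
  intro σ τ h
  have hr : Λ.restrict σ = Λ.restrict τ := funext fun x => h x (hΛ x.2)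
  have hb : boundaryEnergy G Φ Λ (Λ.restrict τ) σ = boundaryEnergy G Φ Λ (Λ.restrict τ) τ :=
    Finset.sum_congr rfl fun x _ => Finset.sum_congr rfl fun y hy => by
      simp only [Finset.mem_filter] at hy
      rw [h y (hN x x.2 hy.1)]
  simp only [gibbsWeight]
  rw [hr, hb]

/-- The DLR equation for functions of finitely many spins. With the density on a large subtree
written as `R * g`, where `g` is the Boltzmann weight of `Λ`, both sides have the same integral over
the spins in `Λ`. -/
theorem HasSubtreeDensities.lintegral_div [DecidableEq V] {k : ℕ} {f : unitInterval → ℝ}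
    (hf : IsPositiveFixedPoint Φ β k f) (hG : G.Connected) {μ : Measure (V → unitInterval)}
    (hμ : HasSubtreeDensities G Φ β k f μ) {Λ A : Finset V}
    (hA : (G.induce (A : Set V)).Connected) (hΛ : Λ ⊆ A) (hN : ∀ x ∈ Λ, G.neighborFinset x ⊆ A)
    {F : (V → unitInterval) → ℝ≥0∞} (hF : Measurable F) (hFA : DependsOn F (A : Set V)) :
    ∫⁻ ω, (∫⋯∫⁻_Λ, (fun σ => F σ * gibbsWeight G Φ β Λ σ (Λ.restrict σ))) ω /
        (∫⋯∫⁻_Λ, (fun σ => gibbsWeight G Φ β Λ σ (Λ.restrict σ))) ω ∂μ = ∫⁻ ω, F ω ∂μ := by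
  have := countable_of_connected G hG
  set g : (V → unitInterval) → ℝ≥0∞ := fun σ => gibbsWeight G Φ β Λ σ (Λ.restrict σ) with hg
  have hgm : Measurable g := measurable_gibbsWeight_restrict hf.continuous_interaction Λ
  have hgA : DependsOn g (A : Set V) := dependsOn_gibbsWeight_restrict hΛ hN
  have hFg : Measurable fun σ => F σ * g σ := hF.mul hgm
  have hFgA : DependsOn (fun σ => F σ * g σ) (A : Set V) := fun σ τ h => by
    simp only [hFA h, hgA h]
  set γ : (V → unitInterval) → ℝ≥0∞ := fun ω =>
    (∫⋯∫⁻_Λ, (fun σ => F σ * g σ)) ω / (∫⋯∫⁻_Λ, g) ω with hγ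
  have hγm : Measurable γ := (hFg.lmarginal fun _ => volume).div (hgm.lmarginal fun _ => volume)
  have hγA : DependsOn γ (A : Set V) := fun σ τ h => by
    simp only [hγ, dependsOn_lmarginal (Λ := Λ) hFgA h, dependsOn_lmarginal (Λ := Λ) hgA h]
  have hγΛ : DependsOn γ (Λ : Set V)ᶜ := fun σ τ h => by
    simp only [hγ]
    rw [lmarginal_congr _ (fun σ => F σ * g σ) fun i hi => h i (by simpa using hi),
      lmarginal_congr _ g fun i hi => h i (by simpa using hi)]
  rw [← ENNReal.mul_left_inj hf.totalMass_ne_zero hf.totalMass_ne_top,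
    hμ.lintegral_mul_totalMass A hA γ hγm hγA 0, hμ.lintegral_mul_totalMass A hA F hF hFA 0]
  refine congrFun (lmarginal_eq_of_subset (f := fun σ => γ σ * weight G Φ β f A σ)
    (g := fun σ => F σ * weight G Φ β f A σ) hΛ (hγm.mul (hf.measurable_weight A))
    (hF.mul (hf.measurable_weight A)) ?_) 0
  obtain ⟨R, hR, hRg⟩ := exists_weight_eq_mul G Φ β f hΛ hN
  have e1 : (fun σ => γ σ * weight G Φ β f A σ) = fun σ => (γ σ * R σ) * g σ := by
    ext σ
    rw [hRg, mul_assoc]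
  have e2 : (fun σ => F σ * weight G Φ β f A σ) = fun σ => R σ * (F σ * g σ) := by
    ext σ
    rw [hRg, mul_left_comm]
  rw [e1, e2, lmarginal_mul_left _ hgm, lmarginal_mul_left hR hFg]
  · ext σ
    have h0 : (∫⋯∫⁻_Λ, g) σ ≠ 0 := by
      rw [hg, ← lintegral_gibbsWeight]
      exact lintegral_ofReal_exp_ne_zero _
        (continuous_energy_add_boundaryEnergy_left hf.continuous_interaction Λ σ)
    have htop : (∫⋯∫⁻_Λ, g) σ ≠ ∞ := by
      rw [hg, ← lintegral_gibbsWeight]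
      exact lintegral_ofReal_exp_ne_top _
        (continuous_energy_add_boundaryEnergy_left hf.continuous_interaction Λ σ)
    rw [mul_comm (γ σ), mul_assoc, hγ, ENNReal.div_mul_cancel h0 htop]
  · intro σ τ h
    simp only [hγΛ h, hR h]

theorem HasSubtreeDensities.isGibbsMeasure [DecidableEq V] {k : ℕ} {f : unitInterval → ℝ}
    (hf : IsPositiveFixedPoint Φ β k f) (hG : G.Connected) {μ : Measure (V → unitInterval)}
    (hμ : HasSubtreeDensities G Φ β k f μ) : IsGibbsMeasure G Φ β μ := by
  have := hμ.isProbabilityMeasure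
  have := countable_of_connected G hG
  obtain ⟨x₀⟩ := hG.nonempty
  refine ⟨inferInstance, fun Λ => ?_⟩
  have hgm : Measurable fun σ => gibbsWeight G Φ β Λ σ (Λ.restrict σ) :=
    measurable_gibbsWeight_restrict hf.continuous_interaction Λ
  let γ : Set (V → unitInterval) → (V → unitInterval) → ℝ≥0∞ := fun B ω =>
    gibbsSpec G Φ β Λ ω {s | glue Λ s ω ∈ B}
  have hglue : ∀ ω, Measurable fun s : Λ → unitInterval => glue Λ s ω := fun ω => by
    refine measurable_pi_lambda _ fun x => ?_
    by_cases hx : x ∈ Λ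
    · simpa [glue, hx] using measurable_pi_apply _
    · simp [glue, hx]
  have hγ : ∀ B, MeasurableSet B → γ B = fun ω =>
      (∫⋯∫⁻_Λ, (fun σ => B.indicator 1 σ * gibbsWeight G Φ β Λ σ (Λ.restrict σ))) ω /
        (∫⋯∫⁻_Λ, (fun σ => gibbsWeight G Φ β Λ σ (Λ.restrict σ))) ω := fun B hB =>
    funext fun ω => gibbsSpec_apply hf.continuous_interaction Λ ω hB
  have hγm : ∀ B, MeasurableSet B → Measurable (γ B) := fun B hB => by
    rw [hγ B hB]
    exact (((measurable_one.indicator hB).mul hgm).lmarginal fun _ => volume).div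
      (hgm.lmarginal fun _ => volume)
  -- the right-hand side of the DLR equation, as a measure in `B`
  let ρ : Measure (V → unitInterval) :=
    Measure.ofMeasurable (fun B _ => ∫⁻ ω, γ B ω ∂μ) (by simp [γ]) (by
      intro B hB hdisj
      rw [← lintegral_tsum fun i => (hγm _ (hB i)).aemeasurable]
      refine lintegral_congr fun ω => ?_
      simp only [γ, Set.mem_iUnion, Set.ofPred_exists]
      exact measure_iUnion (fun i j hij => (hdisj hij).preimage _) fun i => hglue ω (hB i))
  have hρ : ∀ B, MeasurableSet B → ρ B = ∫⁻ ω, γ B ω ∂μ := fun B hB =>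
    Measure.ofMeasurable_apply B hB
  have hlocal : ∀ n, (Λ ∪ Λ.biUnion fun x => G.neighborFinset x) ⊆ ball G x₀ n →
      ∀ S : Set (ball G x₀ n → unitInterval), MeasurableSet S →
        ρ ((ball G x₀ n).restrict ⁻¹' S) = μ ((ball G x₀ n).restrict ⁻¹' S) := by
    intro n hn S hS
    have hS' := Finset.measurable_restrict (X := fun _ => unitInterval) (ball G x₀ n) hS
    rw [hρ _ hS', hγ _ hS', hμ.lintegral_div hf hG (induce_ball_connected G hG x₀ n)
      (Finset.union_subset_left hn)
      (fun x hx => (Finset.subset_biUnion_of_mem (fun x => G.neighborFinset x) hx).trans (Finset.union_subset_right hn))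
      (measurable_one.indicator hS') (dependsOn_indicator_preimage_restrict _ S),
      lintegral_indicator_one hS']
  obtain ⟨m, -, hm⟩ := exists_subset_ball G hG x₀ (Λ ∪ Λ.biUnion fun x => G.neighborFinset x)
  have : IsProbabilityMeasure ρ := ⟨by
    have := hlocal m hm Set.univ MeasurableSet.univ
    rwa [Set.preimage_univ, measure_univ (μ := μ)] at this⟩
  have heq : ρ = μ := by
    refine ext_of_ball hG x₀ fun n _ S hS => ?_
    have hle := ball_mono G hG x₀ (le_max_left n m)
    exact hlocal (max n m) (hm.trans (ball_mono G hG x₀ (le_max_right n m)))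
      (Finset.restrict₂ (π := fun _ => unitInterval) hle ⁻¹' S)
      (Finset.measurable_restrict₂ (X := fun _ => unitInterval) hle hS)
  intro B hB
  rw [← hρ B hB, heq]

end Specification

/-! ### Splitting Gibbs measures -/

/-- On a ball of radius `n ≥ 1`, every vertex of the sphere has two neighbours outside the ball, so
that the density `weight` has the factor `f²` there. It differs from the splitting weight by the
constant factors `f(0)²`. -/
theorem exists_splittingWeight_eq {V : Type*} [DecidableEq V] {G : SimpleGraph V}
    [G.LocallyFinite] (hG : IsCayleyTree G 2) (Φ : Sym2 unitInterval → ℝ) (β : ℝ)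
    {f : unitInterval → ℝ} (hf : ∀ t, 0 < f t) (x₀ : V) {n : ℕ} (hn : 1 ≤ n) :
    ∃ c : ℝ≥0∞, c ≠ 0 ∧ c ≠ ∞ ∧ ∀ s, splittingWeight G Φ β x₀ (boundaryField f) n s =
      c * weight G Φ β f (ball G x₀ n) (Function.updateFinset 0 (ball G x₀ n) s) := by
  set A := ball G x₀ n with hA
  refine ⟨ENNReal.ofReal (Real.exp (-∑ x ∈ A, if G.dist x₀ x = n then 2 * Real.log (f 0) else 0)),
    by simpa using Real.exp_pos _, ENNReal.ofReal_ne_top, fun s => ?_⟩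
  set σ : V → unitInterval := Function.updateFinset 0 A s with hσ
  have hs : s = A.restrict σ := (Function.restrict_updateFinset (0 : V → unitInterval) s).symm
  rw [splittingWeight, weight, ← ENNReal.ofReal_mul (Real.exp_nonneg _), ← Real.exp_add]
  congr 2
  have hE : energy G Φ A s = 2⁻¹ * ∑ x ∈ A, ∑ y ∈ G.neighborFinset x,
      if y ∈ A then Φ s(σ x, σ y) else 0 := by
    rw [← two_mul_energy, ← hs]
    ring
  have hH : (∑ x : A, if G.dist x₀ (x : V) = n then boundaryField f (x : V) (s x) else 0) =
      ∑ x ∈ A, if G.dist x₀ x = n then 2 * Real.log (f (σ x)) - 2 * Real.log (f 0) else 0 := by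
    rw [← Finset.sum_coe_sort A]
    refine Finset.sum_congr rfl fun x _ => ?_
    rw [boundaryField, Real.log_div (hf _).ne' (hf _).ne', hs, mul_sub]
    rfl
  rw [hE, hH, neg_add_eq_sub, eq_sub_iff_add_eq, add_assoc, ← Finset.sum_add_distrib,
    ← mul_assoc, Finset.mul_sum, ← Finset.sum_add_distrib, logWeight]
  refine Finset.sum_congr rfl fun x hx => ?_
  -- the number of neighbours outside the ball
  have hcount : (((G.neighborFinset x).filter fun y => y ∉ A).card : ℝ) =
      if G.dist x₀ x = n then 2 else 0 := by
    have htot := Finset.card_filter_add_card_filter_not (s := G.neighborFinset x) (fun y => y ∈ A)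
    rw [SimpleGraph.card_neighborFinset_eq_degree, hG.2 x] at htot
    split_ifs with hd
    · have := card_neighborFinset_inter_ball G hG.1 x₀ x hn hd
      rw [← hA] at this
      have h2 : ((G.neighborFinset x).filter fun y => y ∉ A).card = 2 := by omega
      rw [h2]
      norm_num
    · rw [Finset.filter_false_of_mem]
      · simp
      · intro y hy
        rw [SimpleGraph.mem_neighborFinset] at hy
        rw [mem_ball G hG.1.connected] at hx
        rw [not_not, hA, mem_ball G hG.1.connected]
        have h1 := hG.1.connected.dist_triangle (u := x₀) (v := x) (w := y)
        rw [SimpleGraph.dist_eq_one_iff_adj.2 hy] at h1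
        omega
  have hout : (∑ y ∈ G.neighborFinset x, if y ∈ A then 0 else Real.log (f (σ x))) =
      if G.dist x₀ x = n then 2 * Real.log (f (σ x)) else 0 := by
    simp_rw [← ite_not (_ ∈ A)]
    rw [← Finset.sum_filter, Finset.sum_const, nsmul_eq_mul, hcount]
    split_ifs <;> simp
  have hsum : (∑ y ∈ G.neighborFinset x,
      if y ∈ A then -β / 2 * Φ s(σ x, σ y) else Real.log (f (σ x))) =
      -β / 2 * (∑ y ∈ G.neighborFinset x, if y ∈ A then Φ s(σ x, σ y) else 0) +
        ∑ y ∈ G.neighborFinset x, if y ∈ A then 0 else Real.log (f (σ x)) := by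
    rw [Finset.mul_sum, ← Finset.sum_add_distrib]
    refine Finset.sum_congr rfl fun y _ => ?_
    split_ifs <;> simp
  rw [hsum, hout]
  split_ifs <;> ring

theorem HasSubtreeDensities.isSplittingGibbsMeasure {V : Type*} [DecidableEq V]
    {G : SimpleGraph V} [G.LocallyFinite] {Φ : Sym2 unitInterval → ℝ} {β : ℝ}
    {f : unitInterval → ℝ} (hf : IsPositiveFixedPoint Φ β 2 f) (hG : IsCayleyTree G 2) (x₀ : V)
    {μ : Measure (V → unitInterval)} (hμ : HasSubtreeDensities G Φ β 2 f μ) :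
    IsSplittingGibbsMeasure G Φ β x₀ (boundaryField f) μ := by
  have := countable_of_connected G hG.1.connected
  refine ⟨hμ.isProbabilityMeasure, fun n hn => ?_⟩
  have hA := induce_ball_connected G hG.1.connected x₀ n
  set A := ball G x₀ n
  obtain ⟨c, hc0, hc, hw⟩ := exists_splittingWeight_eq hG Φ β hf.pos x₀ hn
  have hWm : Measurable fun s => weight G Φ β f A (Function.updateFinset 0 A s) :=
    (hf.measurable_weight A).comp measurable_updateFinset
  have hZ : ∫⁻ s, weight G Φ β f A (Function.updateFinset 0 A s) ∂(aPriori A) = totalMass 2 f :=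
    hf.lmarginal_weight hG hA 0
  have hdens : splittingMarginal G Φ β x₀ (boundaryField f) n = (aPriori A).withDensity fun s =>
      weight G Φ β f A (Function.updateFinset 0 A s) / totalMass 2 f := by
    rw [splittingMarginal]
    congr 1
    ext s
    simp_rw [hw]
    rw [lintegral_const_mul _ hWm, hZ, ENNReal.mul_div_mul_left _ _ hc0 hc]
  change μ.map A.restrict = _
  rw [hdens]
  ext S hS
  have hS' := Finset.measurable_restrict (X := fun _ => unitInterval) A hS
  rw [Measure.map_apply (Finset.measurable_restrict A) hS, withDensity_apply _ hS,
    ← lintegral_indicator_one hS']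
  simp_rw [div_eq_mul_inv]
  rw [lintegral_mul_const _ hWm, ← div_eq_mul_inv,
    ENNReal.eq_div_iff hf.totalMass_ne_zero hf.totalMass_ne_top, mul_comm,
    hμ.lintegral_mul_totalMass A hA _ (measurable_one.indicator hS')
      (dependsOn_indicator_preimage_restrict A S) 0, lmarginal, aPriori, ← lintegral_indicator hS]
  refine lintegral_congr fun s => ?_
  have hr : A.restrict (Function.updateFinset (0 : V → unitInterval) A s) = s :=
    Function.restrict_updateFinset _ _
  by_cases hs : s ∈ S
  · rw [Set.indicator_of_mem hs, Set.indicator_of_mem (by rwa [Set.mem_preimage, hr]),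
      Pi.one_apply, one_mul]
  · rw [Set.indicator_of_notMem hs, Set.indicator_of_notMem (by rwa [Set.mem_preimage, hr]),
      zero_mul]

instance : (volume : Measure unitInterval).IsOpenPosMeasure where
  open_pos U hU hne := by
    obtain ⟨O, hO, rfl⟩ := isOpen_induced_iff.1 hU
    obtain ⟨t, ht⟩ := hne
    have hcl : (t : ℝ) ∈ closure (Set.Ioo (0 : ℝ) 1) := by
      rw [closure_Ioo zero_ne_one]
      exact t.2
    have hpos := (hO.inter isOpen_Ioo).measure_pos volume (mem_closure_iff.1 hcl O hO ht)
    rw [unitInterval.volume_apply]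
    refine (hpos.trans_le (measure_mono ?_)).ne'
    rintro x ⟨hxO, hx⟩
    exact ⟨⟨x, hx.1.le, hx.2.le⟩, hxO, rfl⟩

/-- A measure determines the function `f` up to a constant factor, since the distribution of a
single spin has density proportional to `f^(k+1)`. -/
theorem HasSubtreeDensities.mul_eq_mul {V : Type*} [DecidableEq V] {G : SimpleGraph V}
    [G.LocallyFinite] {Φ : Sym2 unitInterval → ℝ} {β : ℝ} {k : ℕ} {f g : unitInterval → ℝ}
    (hf : IsPositiveFixedPoint Φ β k f) (hg : IsPositiveFixedPoint Φ β k g)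
    (hG : IsCayleyTree G k) {μ : Measure (V → unitInterval)}
    (hμf : HasSubtreeDensities G Φ β k f μ) (hμg : HasSubtreeDensities G Φ β k g μ)
    (t u : unitInterval) : f t * g u = f u * g t := by
  obtain ⟨x⟩ := hG.1.connected.nonempty
  have hone : ∀ {h : unitInterval → ℝ}, HasSubtreeDensities G Φ β k h μ →
      ∀ S : Set unitInterval, MeasurableSet S →
        ∫⁻ t in S, ENNReal.ofReal (Real.exp ((k + 1 : ℕ) * Real.log (h t))) =
          μ ((fun σ => σ x) ⁻¹' S) * totalMass k h := by
    intro h hh S hS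
    have hS' : MeasurableSet ((fun σ : V → unitInterval => σ x) ⁻¹' S) := measurable_pi_apply x hS
    rw [← lintegral_indicator_one hS', hh.lintegral_mul_totalMass {x}
      (by rw [Finset.coe_singleton]; exact induce_singleton_connected G x) _
      (measurable_one.indicator hS') _ 0, lmarginal_singleton, ← lintegral_indicator hS]
    · refine lintegral_congr fun t => ?_
      rw [weight, logWeight_singleton, hG.2 x]
      by_cases ht : t ∈ S <;> simp [ht, Set.indicator]
    · intro σ τ hστ
      classical
      rw [Set.indicator_apply, Set.indicator_apply]
      refine if_congr ?_ rfl rfl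
      rw [Set.mem_preimage, Set.mem_preimage, hστ x (by simp)]
  have hcont : ∀ {h : unitInterval → ℝ}, IsPositiveFixedPoint Φ β k h →
      Continuous fun t => Real.exp ((k + 1 : ℕ) * Real.log (h t)) := fun hh =>
    Real.continuous_exp.comp (continuous_const.mul hh.continuous_log)
  have hae : (fun t => totalMass k g * ENNReal.ofReal (Real.exp ((k + 1 : ℕ) * Real.log (f t))))
      =ᵐ[volume] fun t =>
        totalMass k f * ENNReal.ofReal (Real.exp ((k + 1 : ℕ) * Real.log (g t))) := by
    refine ae_eq_of_forall_setLIntegral_eq_of_sigmaFinite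
      ((hcont hf).measurable.ennreal_ofReal.const_mul _)
      ((hcont hg).measurable.ennreal_ofReal.const_mul _) fun S hS _ => ?_
    rw [lintegral_const_mul _ (hcont hf).measurable.ennreal_ofReal,
      lintegral_const_mul _ (hcont hg).measurable.ennreal_ofReal, hone hμf S hS, hone hμg S hS]
    ring
  have heq : (fun t => (totalMass k g).toReal * Real.exp ((k + 1 : ℕ) * Real.log (f t))) =
      fun t => (totalMass k f).toReal * Real.exp ((k + 1 : ℕ) * Real.log (g t)) := by
    refine (Continuous.ae_eq_iff_eq (volume : Measure unitInterval)
      (continuous_const.mul (hcont hf)) (continuous_const.mul (hcont hg))).1 ?_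
    filter_upwards [hae] with t ht
    simpa [ENNReal.toReal_mul, ENNReal.toReal_ofReal, Real.exp_nonneg] using
      congrArg ENNReal.toReal ht
  have hZf := ENNReal.toReal_pos hf.totalMass_ne_zero hf.totalMass_ne_top
  have hZg := ENNReal.toReal_pos hg.totalMass_ne_zero hg.totalMass_ne_top
  have hpow : ∀ s, (totalMass k g).toReal * f s ^ (k + 1) =
      (totalMass k f).toReal * g s ^ (k + 1) := fun s => by
    have := congrFun heq s
    simpa only [Real.exp_nat_mul, Real.exp_log (hf.pos s), Real.exp_log (hg.pos s)] using this
  refine (pow_left_inj₀ (n := k + 1) (mul_pos (hf.pos _) (hg.pos _)).le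
    (mul_pos (hf.pos _) (hg.pos _)).le (Nat.succ_ne_zero k)).1 ?_
  rw [mul_pow, mul_pow]
  refine mul_left_cancel₀ (mul_pos hZg hZf).ne' ?_
  linear_combination (totalMass k f).toReal * g u ^ (k + 1) * hpow t -
    (totalMass k f).toReal * g t ^ (k + 1) * hpow u

/-! ### The two fixed points -/

theorem fifthRoot_eq_of_pow_eq {x y : ℝ} (h : y ^ 5 = x) : fifthRoot x = y :=
  (show Odd 5 by decide).strictMono_pow.injective (by rw [fifthRoot_pow, h])

theorem fifthRoot_mul (x y : ℝ) : fifthRoot (x * y) = fifthRoot x * fifthRoot y :=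
  fifthRoot_eq_of_pow_eq (by rw [mul_pow, fifthRoot_pow, fifthRoot_pow])

theorem fifthRoot_neg (x : ℝ) : fifthRoot (-x) = -fifthRoot x :=
  fifthRoot_eq_of_pow_eq (by rw [Odd.neg_pow (by decide), fifthRoot_pow])

theorem fifthRoot_four : fifthRoot 4 = fifthRoot 2 ^ 2 := by
  rw [sq, ← fifthRoot_mul]
  norm_num

theorem fifthRoot_strictMono : StrictMono fifthRoot := fun x y h => by
  refine (show Odd 5 by decide).strictMono_pow.lt_iff_lt.1 ?_
  rwa [fifthRoot_pow, fifthRoot_pow]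

theorem abs_fifthRoot_le_one {x : ℝ} (h : |x| ≤ 1) : |fifthRoot x| ≤ 1 := by
  have h1 : fifthRoot 1 = 1 := fifthRoot_eq_of_pow_eq (by norm_num)
  rw [abs_le] at h ⊢
  constructor
  · rw [← h1, ← fifthRoot_neg]
    exact fifthRoot_strictMono.monotone h.1
  · rw [← h1]
    exact fifthRoot_strictMono.monotone h.2

theorem continuous_fifthRoot : Continuous fifthRoot := by
  have h : fifthRoot = fun x => (max x 0) ^ (1 / 5 : ℝ) - (max (-x) 0) ^ (1 / 5 : ℝ) := by
    ext x
    rcases lt_trichotomy x 0 with hx | rfl | hx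
    · rw [fifthRoot, sign_neg hx, abs_of_neg hx, max_eq_right hx.le, max_eq_left (by linarith),
        Real.zero_rpow (by norm_num)]
      simp
    · simp [fifthRoot]
    · rw [fifthRoot, sign_pos hx, abs_of_pos hx, max_eq_left hx.le, max_eq_right (by linarith),
        Real.zero_rpow (by norm_num)]
      simp
  rw [h]
  exact ((continuous_id.max continuous_const).rpow_const fun _ => Or.inr (by norm_num)).sub
    ((continuous_neg.max continuous_const).rpow_const fun _ => Or.inr (by norm_num))

/-- The function `(2 (t - 1/2))^{1/5}`, with values in `[-1, 1]`, in terms of which the kernel is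
`1 + (14/15) a(t) a(u)` and `f₂ = 3/4 + (√(21/5) / 4) a`. -/
def rootProfile (t : unitInterval) : ℝ := fifthRoot 2 * fifthRoot ((t : ℝ) - 1 / 2)

theorem continuous_rootProfile : Continuous rootProfile :=
  continuous_const.mul (continuous_fifthRoot.comp (by fun_prop))

theorem abs_rootProfile_le_one (t : unitInterval) : |rootProfile t| ≤ 1 := by
  rw [rootProfile, ← fifthRoot_mul]
  refine abs_fifthRoot_le_one ?_
  have h0 := t.2.1
  have h1 := t.2.2
  rw [abs_le]
  constructor <;> linarith

theorem fifthRoot_four_mul (t u : unitInterval) :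
    fifthRoot (4 * ((t : ℝ) - 1 / 2) * ((u : ℝ) - 1 / 2)) = rootProfile t * rootProfile u := by
  rw [fifthRoot_mul, fifthRoot_mul, fifthRoot_four, rootProfile, rootProfile]
  ring

theorem one_add_pos (t u : unitInterval) : 0 < 1 + 14 / 15 * (rootProfile t * rootProfile u) := by
  have h : |rootProfile t * rootProfile u| ≤ 1 := by
    rw [abs_mul]
    exact mul_le_one₀ (abs_rootProfile_le_one t) (abs_nonneg _) (abs_rootProfile_le_one u)
  rw [abs_le] at h
  linarith

theorem modelInteraction_mk (β : ℝ) (t u : unitInterval) : modelInteraction β s(t, u) =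
    -(1 / β) * Real.log (1 + 14 / 15 * (rootProfile t * rootProfile u)) := by
  rw [← fifthRoot_four_mul]
  rfl

theorem kernel_modelInteraction {β : ℝ} (hβ : 0 < β) (t u : unitInterval) :
    kernel (modelInteraction β) β t u = 1 + 14 / 15 * (rootProfile t * rootProfile u) := by
  rw [kernel, modelInteraction_mk, ← mul_assoc, neg_mul_neg, mul_one_div_cancel hβ.ne', one_mul,
    Real.exp_log (one_add_pos t u)]

theorem continuous_modelInteraction (β : ℝ) :
    Continuous fun p : unitInterval × unitInterval => modelInteraction β s(p.1, p.2) := by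
  simp_rw [modelInteraction_mk]
  refine continuous_const.mul (Continuous.log ?_ fun p => (one_add_pos p.1 p.2).ne')
  exact continuous_const.add (continuous_const.mul
    ((continuous_rootProfile.comp continuous_fst).mul (continuous_rootProfile.comp continuous_snd)))

theorem f₂_eq (t : unitInterval) : f₂ t = 3 / 4 + √(21 / 5) / 4 * rootProfile t := by
  rw [f₂, rootProfile]
  ring

theorem rootProfile_symm (t : unitInterval) :
    rootProfile (unitInterval.symm t) = -rootProfile t := by
  rw [rootProfile, rootProfile, unitInterval.coe_symm_eq, ← mul_neg, ← fifthRoot_neg]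
  congr 2
  ring

theorem integral_rootProfile_pow_of_odd {n : ℕ} (hn : Odd n) : ∫ t, rootProfile t ^ n = 0 := by
  have h := unitInterval.measurePreserving_symm.integral_comp
    unitInterval.symmMeasurableEquiv.measurableEmbedding fun t => rootProfile t ^ n
  simp_rw [rootProfile_symm, hn.neg_pow, integral_neg] at h
  linarith

theorem fifthRoot_sq (x : ℝ) : fifthRoot x ^ 2 = |x| ^ (2 / 5 : ℝ) := by
  rw [fifthRoot, mul_pow, ← Real.rpow_mul_natCast (abs_nonneg x)]
  rcases lt_trichotomy x 0 with hx | rfl | hx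
  · rw [sign_neg hx]; norm_num
  · norm_num
  · rw [sign_pos hx]; norm_num

theorem integral_rootProfile_sq : ∫ t, rootProfile t ^ 2 = 5 / 7 := by
  have h1 : ∫ t : unitInterval, rootProfile t ^ 2 =
      ∫ x in (0 : ℝ)..1, |2 * x - 1| ^ (2 / 5 : ℝ) := by
    rw [intervalIntegral.integral_of_le zero_le_one, ← integral_Icc_eq_integral_Ioc,
      ← unitInterval.measurePreserving_coe.integral_comp unitInterval.measurableEmbedding_coe]
    refine integral_congr_ae (.of_forall fun t => ?_)
    simp only [rootProfile]
    rw [← fifthRoot_mul, fifthRoot_sq]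
    congr 2
    ring
  have h2 : ∫ x in (0 : ℝ)..1, |x| ^ (2 / 5 : ℝ) = 5 / 7 := by
    rw [intervalIntegral.integral_congr (g := fun x => x ^ (2 / 5 : ℝ)), integral_rpow (by norm_num)]
    · norm_num
    · intro x hx
      rw [Set.uIcc_of_le zero_le_one] at hx
      simp only [abs_of_nonneg hx.1]
  have hc : Continuous fun x : ℝ => |x| ^ (2 / 5 : ℝ) :=
    continuous_abs.rpow_const fun _ => Or.inr (by norm_num)
  have h3 : ∫ x in (-1 : ℝ)..0, |x| ^ (2 / 5 : ℝ) = 5 / 7 := by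
    have := intervalIntegral.integral_comp_neg (a := 0) (b := 1) fun x : ℝ => |x| ^ (2 / 5 : ℝ)
    simp only [abs_neg, neg_zero] at this
    rw [← this, h2]
  rw [h1, intervalIntegral.integral_comp_mul_sub (fun x => |x| ^ (2 / 5 : ℝ)) two_ne_zero 1]
  norm_num
  rw [← intervalIntegral.integral_add_adjacent_intervals (b := 0) (hc.intervalIntegrable _ _)
    (hc.intervalIntegrable _ _)]
  norm_num at h2 h3
  rw [h2, h3]
  norm_num

theorem integral_cubic_rootProfile (a b c d : ℝ) :
    ∫ u, (a + b * rootProfile u ^ 1 + c * rootProfile u ^ 2 + d * rootProfile u ^ 3) =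
      a + 5 / 7 * c := by
  have hI : ∀ (e : ℝ) (n : ℕ), Integrable fun u => e * rootProfile u ^ n := fun e n =>
    integrable_of_continuous_of_compactSpace _ (continuous_const.mul (continuous_rootProfile.pow n))
  have h1 : Integrable fun u => a + b * rootProfile u ^ 1 := (integrable_const a).add (hI b 1)
  have h2 : Integrable fun u => a + b * rootProfile u ^ 1 + c * rootProfile u ^ 2 :=
    h1.add (hI c 2)
  rw [integral_add h2 (hI d 3), integral_add h1 (hI c 2), integral_add (integrable_const a) (hI b 1),
    integral_const_mul, integral_const_mul, integral_const_mul,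
    integral_rootProfile_pow_of_odd (n := 1) (by decide),
    integral_rootProfile_pow_of_odd (n := 3) (by decide), integral_rootProfile_sq]
  simp
  ring

/-- The Hammerstein operator of order `2` maps affine functions of `rootProfile` to affine functions
of `rootProfile`, because the odd moments of `rootProfile` vanish. -/
theorem hammerstein_affine {β : ℝ} (hβ : 0 < β) (p q : ℝ) (t : unitInterval) :
    hammerstein (kernel (modelInteraction β) β) 2 (fun u => p + q * rootProfile u) t =
      p ^ 2 + 5 / 7 * q ^ 2 + 4 / 3 * p * q * rootProfile t := by
  have hexp : ∀ u, kernel (modelInteraction β) β t u * (p + q * rootProfile u) ^ 2 =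
      p ^ 2 + (2 * p * q + 14 / 15 * rootProfile t * p ^ 2) * rootProfile u ^ 1 +
        (q ^ 2 + 28 / 15 * rootProfile t * p * q) * rootProfile u ^ 2 +
        14 / 15 * rootProfile t * q ^ 2 * rootProfile u ^ 3 := fun u => by
    rw [kernel_modelInteraction hβ]
    ring
  simp_rw [hammerstein, hexp]
  rw [integral_cubic_rootProfile]
  ring

theorem isPositiveFixedPoint_f₁ {β : ℝ} (hβ : 0 < β) :
    IsPositiveFixedPoint (modelInteraction β) β 2 f₁ where
  continuous_interaction := continuous_modelInteraction β
  continuous := continuous_const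
  pos _ := one_pos
  fixed t := by
    have h : f₁ = fun u => 1 + 0 * rootProfile u := by
      ext u
      simp [f₁]
    rw [h, hammerstein_affine hβ]
    ring

theorem isPositiveFixedPoint_f₂ {β : ℝ} (hβ : 0 < β) :
    IsPositiveFixedPoint (modelInteraction β) β 2 f₂ where
  continuous_interaction := continuous_modelInteraction β
  continuous := by
    rw [show f₂ = _ from funext f₂_eq]
    exact continuous_const.add (continuous_const.mul continuous_rootProfile)
  pos t := by
    rw [f₂_eq]
    have h1 := abs_le.1 (abs_rootProfile_le_one t)
    have h2 : √(21 / 5) < 3 := by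
      rw [Real.sqrt_lt' (by norm_num)]
      norm_num
    nlinarith [Real.sqrt_nonneg (21 / 5)]
  fixed t := by
    have hs : √(21 / 5) ^ 2 = 21 / 5 := Real.sq_sqrt (by norm_num)
    rw [show f₂ = _ from funext f₂_eq, hammerstein_affine hβ]
    linear_combination 5 / 112 * hs

theorem f₂_zero_lt_f₂_one : f₂ 0 < f₂ 1 := by
  rw [f₂_eq, f₂_eq]
  have h2 : 0 < fifthRoot 2 := by
    rw [← fifthRoot_eq_of_pow_eq (x := 0) (y := 0) (by norm_num)]
    exact fifthRoot_strictMono two_pos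
  have hr : rootProfile 0 < rootProfile 1 :=
    mul_lt_mul_of_pos_left (fifthRoot_strictMono (by simp)) h2
  have : 0 < √(21 / 5 : ℝ) := by positivity
  gcongr

end CayleyGibbs
end

theorem theorem3p2 {V : Type*} (G : SimpleGraph V) [G.LocallyFinite]
    (hG : CayleyGibbs.IsCayleyTree G 2) (x₀ : V) (β : ℝ) (hβ : 0 < β) :
    (∀ f ∈ ({CayleyGibbs.f₁, CayleyGibbs.f₂} : Set (unitInterval → ℝ)),
      Continuous f ∧ (∀ t, 0 < f t) ∧
        ∀ t, CayleyGibbs.hammerstein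
          (CayleyGibbs.kernel (CayleyGibbs.modelInteraction β) β) 2 f t = f t) ∧
    CayleyGibbs.f₁ ≠ CayleyGibbs.f₂ ∧
    ∃ μ₁ μ₂ : MeasureTheory.Measure (V → unitInterval),
      μ₁ ≠ μ₂ ∧
      (CayleyGibbs.IsGibbsMeasure G (CayleyGibbs.modelInteraction β) β μ₁ ∧
        CayleyGibbs.IsTranslationInvariant G μ₁ ∧
        CayleyGibbs.IsSplittingGibbsMeasure G (CayleyGibbs.modelInteraction β) β x₀
          (CayleyGibbs.boundaryField CayleyGibbs.f₁) μ₁) ∧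
      (CayleyGibbs.IsGibbsMeasure G (CayleyGibbs.modelInteraction β) β μ₂ ∧
        CayleyGibbs.IsTranslationInvariant G μ₂ ∧
        CayleyGibbs.IsSplittingGibbsMeasure G (CayleyGibbs.modelInteraction β) β x₀
          (CayleyGibbs.boundaryField CayleyGibbs.f₂) μ₂) := by
  classical
  have h₁ := CayleyGibbs.isPositiveFixedPoint_f₁ hβ
  have h₂ := CayleyGibbs.isPositiveFixedPoint_f₂ hβ
  have hc := hG.1.connected
  obtain ⟨μ₁, hμ₁⟩ := CayleyGibbs.exists_hasSubtreeDensities h₁ hG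
  obtain ⟨μ₂, hμ₂⟩ := CayleyGibbs.exists_hasSubtreeDensities h₂ hG
  refine ⟨?_, ?_, μ₁, μ₂, ?_,
    ⟨hμ₁.isGibbsMeasure h₁ hc, hμ₁.isTranslationInvariant h₁ hc,
      hμ₁.isSplittingGibbsMeasure h₁ hG x₀⟩,
    ⟨hμ₂.isGibbsMeasure h₂ hc, hμ₂.isTranslationInvariant h₂ hc,
      hμ₂.isSplittingGibbsMeasure h₂ hG x₀⟩⟩
  · rintro f (rfl | rfl)
    · exact ⟨h₁.continuous, h₁.pos, h₁.fixed⟩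
    · exact ⟨h₂.continuous, h₂.pos, h₂.fixed⟩
  · intro h
    have := CayleyGibbs.f₂_zero_lt_f₂_one
    rw [← h] at this
    exact lt_irrefl _ this
  · rintro rfl
    have := hμ₁.mul_eq_mul h₁ h₂ hG hμ₂ 0 1
    simp only [CayleyGibbs.f₁, one_mul] at this
    exact CayleyGibbs.f₂_zero_lt_f₂_one.ne' this
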